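/- Let $\mathscr P=\{\mathscr P_{n,\pm}\}_{n\ge 0}$ be a $C^*$-planar algebra, i.e. a shaded planar algebra with involution in which every box space $\mathscr P_{n,\pm}$ is a finite-dimensional $C^*$-algebra under vertical stacking ($xy$ has $x$ at the bottom and $y$ on top), with a faithful positive (unnormalised) trace $tr_{n,\pm}$ obtained by closing all strings around one side and applying a linear functional $tr_{0,\pm}$ on $\mathscr P_{0,\pm}$. No sphericality and no condition $\dim\mathscr P_{0,\pm}=1$ is assumed. Let $x\in\mathscr P_{2,\pm}$, and let $\widehat x=\mathfrak F(x)\in\mathscr P_{2,\mp}$ be its Fourier transform, the clockwise rotation of $x$ by $90^\circ$. Suppose that $x$ is $\mathfrak F$-positive, i.e. $\widehat x$ is a positive element of the $C^*$-algebra $\mathscr P_{2,\mp}$. Let $r$ be the spectral radius of $x$ in $\mathscr P_{2,\pm}$. For $y\in\mathscr P_{1,\pm}$ let $y*\widehat x\in\mathscr P_{1,\pm}$ be the $1$-box obtained by placing $y$ to the left of $\widehat x$ and joining the top and the bottom of $y$ to the top and the bottom of the left string of $\widehat x$. For $z\in\mathscr P_{1,\mp}$ let $\widehat x*z\in\mathscr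 P_{1,\mp}$ be obtained by placing $z$ to the right of $\widehat x$ and joining it in the same way to the right string of $\widehat x$. Let $\overline{z}$ denote the rotation of a $1$-box $z$ by $180^\circ$, and let $\mathcal R(y)$ be the range projection of a positive element $y$. Put $$\mathcal E=\{y\in\mathscr P_{1,\pm}: y*\widehat x=ry\},\qquad \mathcal E^+=\{y\in\mathcal E: y\ge 0\},$$ let $p_{\max}$ be the largest projection in $\{\mathcal R(y): y\in\mathcal E^+\}$, and put $$\zeta=\lim_{\mathbb R\ni z\to r^+}(z-r)\sum_{j=0}^\infty\frac{p_{\max}*\widehat x^{\,*j}}{z^{j+1}}\in\mathcal E^+,$$ where $p_{\max}*\widehat x^{\,*j}$ is the result of applying $y\mapsto y*\widehat x$ to $p_{\max}$ $j$ times. Let $\mathcal C\subseteq\mathscr P_{1,\pm}$ be the $C^*$-algebra of all $y$ such that $x$ commutes with the $2$-box having $y$ on its left string and a straight right string, and also with the $2$-box having a straight left string and $\overline y$ on its right string. Let $\mathcal C^+$ be the set of its positive elements. Suppose that there is a right PF eigenvector $y_1$ of $x$, i.e. a nonzero positive $y_1\in\mathscr P_{1,\mp}$ with $\widehat x*y_1=ry_1$,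 such that $p_{\max}=\overline{\mathcal R(y_1)}$. Suppose also that $\zeta\,\mathcal R(y)=\mathcal R(y)\,\zeta$ for every $y\in\mathcal E^+$. Then $$\mathcal E^+=\zeta\,\mathcal C^+=\{\zeta c: c\in\mathcal C^+\}.$$ -/

import Mathlib

open Filter Topology

universe u

noncomputable section

/-!
# Shaded planar algebras

A planar tangle is drawn as a rectangle, with some marked points on the bottom edge, some on the
top edge, and a checkerboard shading of its regions.  Up to planar isotopy every such picture is
obtained from the boxes and from straight strings, cups and caps by vertical stacking and
horizontal juxtaposition, and two such decompositions describe isotopic pictures exactly when they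
are related by associativity and units, the interchange law, straightening of a bent string, and
invariance of a box under a rotation by `2π`.  A shaded planar algebra is therefore presented as a
strict pivotal linear 2-category: two objects (the two shadings of a region) and the 1-morphisms
generated by one string, which separates regions of opposite shadings.
-/

/-- The shading of a region. -/
abbrev Shading : Type := Bool

/-- The shading that is reached from a region of shading `ε` after crossing `n` strings. -/
def shade (ε : Shading) (n : ℕ) : Shading := xor ε n.bodd

theorem shade_zero (ε : Shading) : shade ε 0 = ε := by cases ε <;> rfl

theorem shade_one (ε : Shading) : shade ε 1 = !ε := by cases ε <;> rfl

theorem shade_two (ε : Shading) : shade ε 2 = ε := by cases ε <;> rfl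

theorem shade_one_of {ε η : Shading} (h : η = !ε) : shade ε 1 = η := by
  subst h; exact shade_one ε

theorem shade_one_of' {ε η : Shading} (h : η = !ε) : shade η 1 = ε := by
  subst h; cases ε <;> rfl

theorem shade_three_of' {ε η : Shading} (h : η = !ε) : shade η 3 = ε := by
  subst h; cases ε <;> rfl

theorem opp_symm {ε η : Shading} (h : η = !ε) : ε = !η := by
  subst h; cases ε <;> rfl

/-- The operations of a shaded planar algebra with involution.  `Hom ε a b` is the space of
pictures with `a` points on the bottom edge, `b` points on the top edge, and a leftmost region of
shading `ε`; the `n`-boxes are the case `a = b = n`.  Bending strings identifies `Hom ε a b` with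
the space of `(a + b) / 2`-boxes, so the cases `a ≠ b` carry no further information. -/
structure PlanarData where
  Hom : Shading → ℕ → ℕ → Type u
  [addCommGroup : ∀ ε a b, AddCommGroup (Hom ε a b)]
  [module : ∀ ε a b, Module ℂ (Hom ε a b)]
  /-- Straight vertical strings. -/
  ident : ∀ ε a, Hom ε a a
  /-- `comp f g` is the picture with `f` at the bottom and `g` on top of it. -/
  comp : ∀ {ε : Shading} {a b c : ℕ}, Hom ε a b →ₗ[ℂ] Hom ε b c →ₗ[ℂ] Hom ε a c
  /-- `tensor h f g` is the picture with `f` on the left and `g` on the right. -/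
  tensor : ∀ {ε η : Shading} {a b c d : ℕ}, shade ε a = η →
    Hom ε a b →ₗ[ℂ] Hom η c d →ₗ[ℂ] Hom ε (a + c) (b + d)
  /-- The string that connects two points of the top edge. -/
  cup : ∀ ε, Hom ε 0 2
  /-- The string that connects two points of the bottom edge. -/
  cap : ∀ ε, Hom ε 2 0
  /-- The involution: adjoints of the labels, and reflection of the picture in a horizontal
  line. -/
  dagger : ∀ {ε : Shading} {a b : ℕ}, Hom ε a b →ₗ⋆[ℂ] Hom ε b a

attribute [instance] PlanarData.addCommGroup PlanarData.module

namespace PlanarData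

variable (P : PlanarData.{u})

/-- Transport along equalities of the numbers of boundary points. -/
def castHom {ε : Shading} {a a' b b' : ℕ} (ha : a = a') (hb : b = b') (f : P.Hom ε a b) :
    P.Hom ε a' b' :=
  hb ▸ ha ▸ f

/-- The one-click rotation of a picture whose `n + 1` points are all on the top edge: the leftmost
string is bent around the picture and becomes the rightmost one. -/
def rot {ε η : Shading} (h : η = !ε) {n : ℕ} (f : P.Hom ε 0 (n + 1)) : P.Hom η 0 (n + 1) :=
  P.castHom rfl (Nat.zero_add (n + 1))
    (P.comp
      (P.castHom rfl (by omega : 1 + (n + 1) + 1 = 2 + (n + 1))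
        (P.comp (P.cup η)
          (P.tensor (shade_one η) (P.tensor (shade_one_of' h) (P.ident η 1) f)
            (P.ident (!η) 1))))
      (P.tensor (shade_two η) (P.cap η) (P.ident η (n + 1))))

/-- The two-click rotation. -/
def rotTwo {ε : Shading} {n : ℕ} (f : P.Hom ε 0 (n + 1)) : P.Hom ε 0 (n + 1) :=
  P.rot (opp_symm (rfl : (!ε) = !ε)) (P.rot (rfl : (!ε) = !ε) f)

end PlanarData

/-- A shaded planar algebra with involution (a planar `*`-algebra). -/
structure PlanarStarAlgebra extends PlanarData.{u} where
  /-- A checkerboard shading forces an even number of boundary points. -/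
  odd_eq_zero : ∀ {ε : Shading} {a b : ℕ}, (a + b) % 2 = 1 → ∀ f : Hom ε a b, f = 0
  ident_comp : ∀ {ε : Shading} {a b : ℕ} (f : Hom ε a b), comp (ident ε a) f = f
  comp_ident : ∀ {ε : Shading} {a b : ℕ} (f : Hom ε a b), comp f (ident ε b) = f
  comp_assoc : ∀ {ε : Shading} {a b c d : ℕ} (f : Hom ε a b) (g : Hom ε b c) (k : Hom ε c d),
    comp (comp f g) k = comp f (comp g k)
  ident_tensor_ident : ∀ {ε η : Shading} {a c : ℕ} (h : shade ε a = η),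
    tensor h (ident ε a) (ident η c) = ident ε (a + c)
  /-- The interchange law. -/
  tensor_comp : ∀ {ε η : Shading} {a b c a' b' c' : ℕ} (h : shade ε a = η) (h' : shade ε b = η)
    (f : Hom ε a b) (g : Hom ε b c) (f' : Hom η a' b') (g' : Hom η b' c'),
    tensor h (comp f g) (comp f' g') = comp (tensor h f f') (tensor h' g g')
  empty_tensor : ∀ {ε : Shading} {a b : ℕ} (f : Hom ε a b),
    HEq (tensor (shade_zero ε) (ident ε 0) f) f
  tensor_empty : ∀ {ε η : Shading} {a b : ℕ} (h : shade ε a = η) (f : Hom ε a b),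
    tensor h f (ident η 0) = f
  tensor_assoc : ∀ {ε η θ : Shading} {a b c d i j : ℕ} (h : shade ε a = η) (h' : shade η c = θ)
    (h'' : shade ε (a + c) = θ) (f : Hom ε a b) (g : Hom η c d) (k : Hom θ i j),
    HEq (tensor h'' (tensor h f g) k) (tensor h f (tensor h' g k))
  /-- A bent string can be straightened. -/
  zigzag : ∀ ε : Shading,
    comp (tensor (shade_one ε) (ident ε 1) (cup (!ε)))
      (tensor (shade_two ε) (cap ε) (ident ε 1)) = ident ε 1
  /-- A bent string can be straightened. -/
  zigzag' : ∀ ε : Shading,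
    comp (tensor (shade_zero ε) (cup ε) (ident ε 1))
      (tensor (shade_one ε) (ident ε 1) (cap (!ε))) = ident ε 1
  /-- A rotation by `2π` of a box with `2 * (n + 1)` boundary points is the identity. -/
  rotTwo_iterate : ∀ {ε : Shading} {n : ℕ} (f : Hom ε 0 (2 * n + 1 + 1)),
    (toPlanarData.rotTwo)^[n + 1] f = f
  dagger_dagger : ∀ {ε : Shading} {a b : ℕ} (f : Hom ε a b), dagger (dagger f) = f
  dagger_comp : ∀ {ε : Shading} {a b c : ℕ} (f : Hom ε a b) (g : Hom ε b c),
    dagger (comp f g) = comp (dagger g) (dagger f)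
  dagger_tensor : ∀ {ε η : Shading} {a b c d : ℕ} (h : shade ε a = η) (h' : shade ε b = η)
    (f : Hom ε a b) (g : Hom η c d), dagger (tensor h f g) = tensor h' (dagger f) (dagger g)
  dagger_cup : ∀ ε : Shading, dagger (cup ε) = cap ε

namespace PlanarStarAlgebra

variable (P : PlanarStarAlgebra.{u})

/-- The `n`-box space with leftmost region of shading `ε`: `n` points on the bottom edge and `n`
points on the top edge. -/
def Box (ε : Shading) (n : ℕ) : Type u := P.Hom ε n n

variable {P} {ε η : Shading} {n : ℕ}

instance : AddCommGroup (P.Box ε n) := inferInstanceAs (AddCommGroup (P.Hom ε n n))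

/-- The product `x * y` of two boxes has `x` at the bottom and `y` on top. -/
instance : Ring (P.Box ε n) where
  __ := (inferInstance : AddCommGroup (P.Box ε n))
  mul x y := P.comp x y
  one := P.ident ε n
  zero_mul x := LinearMap.map_zero₂ P.comp x
  mul_zero x := map_zero (P.comp x)
  left_distrib x y z := map_add (P.comp x) y z
  right_distrib x y z := LinearMap.map_add₂ P.comp x y z
  mul_assoc x y z := P.comp_assoc x y z
  one_mul x := P.ident_comp x
  mul_one x := P.comp_ident x

instance : Module ℂ (P.Box ε n) := inferInstanceAs (Module ℂ (P.Hom ε n n))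

instance : Algebra ℂ (P.Box ε n) :=
  Algebra.ofModule
    (fun c x y => LinearMap.map_smul₂ P.comp c x y)
    (fun c x y => map_smul (P.comp x) c y)

instance : StarRing (P.Box ε n) where
  star x := P.dagger x
  star_involutive x := P.dagger_dagger x
  star_mul x y := P.dagger_comp x y
  star_add x y := map_add P.dagger x y

instance : StarModule ℂ (P.Box ε n) where
  star_smul c x := P.dagger.map_smulₛₗ c x

variable (P) in
/-- The closed picture obtained by joining the top points of a box to its bottom points around
the right-hand side. -/
def closure : ∀ n : ℕ, P.Box ε n → P.Box ε 0
  | 0, f => f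
  | n + 1, f => closure n
      (P.comp (P.tensor rfl (P.ident ε n) (P.cup (shade ε n)))
        (P.comp (P.tensor (a := n + 1) (b := n + 1) rfl f (P.ident (shade ε (n + 1)) 1))
          (P.tensor rfl (P.ident ε n) (P.cap (shade ε n)))))

end PlanarStarAlgebra

/-- A `C*`-planar algebra: a shaded planar `*`-algebra whose box spaces are finite-dimensional
`C*`-algebras, with faithful positive (unnormalised) traces `tr n` that come from functionals `tr₀`
on the `0`-box spaces by closing up the strings. -/
structure CStarPlanarAlgebra extends PlanarStarAlgebra.{u} where
  finiteDimensional : ∀ ε n, FiniteDimensional ℂ (toPlanarStarAlgebra.Box ε n)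
  boxNorm : ∀ ε n, RingNorm (toPlanarStarAlgebra.Box ε n)
  boxNorm_smul : ∀ {ε n} (c : ℂ) (x : toPlanarStarAlgebra.Box ε n),
    boxNorm ε n (c • x) = ‖c‖ * boxNorm ε n x
  boxNorm_star_mul_self : ∀ {ε n} (x : toPlanarStarAlgebra.Box ε n),
    boxNorm ε n (star x * x) = boxNorm ε n x * boxNorm ε n x
  tr₀ : ∀ ε, toPlanarStarAlgebra.Box ε 0 →ₗ[ℂ] ℂ
  tr_pos : ∀ {ε n} (x : toPlanarStarAlgebra.Box ε n), x ≠ 0 →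
    0 < (tr₀ ε (toPlanarStarAlgebra.closure n (x * star x))).re ∧
      (tr₀ ε (toPlanarStarAlgebra.closure n (x * star x))).im = 0

namespace CStarPlanarAlgebra

variable (P : CStarPlanarAlgebra.{u})

/-- The `n`-box spaces of a `C*`-planar algebra. -/
abbrev Box (ε : Shading) (n : ℕ) : Type u := P.toPlanarStarAlgebra.Box ε n

variable {P} {ε η : Shading} {n : ℕ}

instance : FiniteDimensional ℂ (P.Box ε n) := P.finiteDimensional ε n

instance : NormedRing (P.Box ε n) := (P.boxNorm ε n).toNormedRing

instance : NormedAlgebra ℂ (P.Box ε n) where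
  norm_smul_le c x := (P.boxNorm_smul c x).le

instance : CompleteSpace (P.Box ε n) := FiniteDimensional.complete ℂ _

instance : CStarRing (P.Box ε n) where
  norm_mul_self_le x := (P.boxNorm_star_mul_self x).ge

instance : CStarAlgebra (P.Box ε n) where

/-- Positive elements of a box space. -/
def IsPos (x : P.Box ε n) : Prop := ∃ y : P.Box ε n, x = y * star y

/-- `q` is the range projection of `y`: the smallest projection with `q * y = y`. -/
def IsRangeProj (q y : P.Box ε n) : Prop :=
  IsStarProjection q ∧ q * y = y ∧
    ∀ q' : P.Box ε n, IsStarProjection q' → q' * y = y → q' * q = q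

/-- The range projection `R(y)`. -/
def rangeProj (y : P.Box ε n) : P.Box ε n := Classical.epsilon fun q => IsRangeProj q y

/-- The conjugate `ȳ` of a `1`-box: its rotation by `π`. -/
def conj (h : η = !ε) (y : P.Box ε 1) : P.Box η 1 :=
  P.comp (P.tensor (shade_one_of' h) (P.ident η 1) (P.cup ε))
    (P.comp
      (P.tensor (shade_two η)
        (P.tensor (b := 1) (d := 1) (shade_one_of' h) (P.ident η 1) y) (P.ident η 1))
      (P.tensor (shade_two η) (P.cap η) (P.ident η 1)))

/-- The Fourier transform of a `2`-box: its clockwise rotation by `π / 2`.  The bottom left string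
is bent to the top and the top right string is bent to the bottom. -/
def fourier (h : η = !ε) (x : P.Box ε 2) : P.Box η 2 :=
  P.comp (P.tensor (shade_zero η) (P.cup η) (P.ident η 2))
    (P.comp
      (P.tensor (a := 3) (b := 3) (shade_three_of' h)
        (P.tensor (b := 1) (d := 2) (shade_one_of' h) (P.ident η 1) x) (P.ident ε 1))
      (P.tensor (shade_two η) (P.ident η 2) (P.cap η)))

/-- The convolution `y ∗ a` of a `1`-box with a `2`-box: the top and the bottom of `y`, on the
left, are joined to the left string of `a`. -/
def convLeft (h : η = !ε) (y : P.Box ε 1) (a : P.Box η 2) : P.Box ε 1 :=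
  P.comp (P.tensor (shade_zero ε) (P.cup ε) (P.ident ε 1))
    (P.comp (P.tensor (b := 1) (d := 2) (shade_one_of h) y a)
      (P.tensor (shade_two ε) (P.cap ε) (P.ident ε 1)))

/-- The convolution `a ∗ z` of a `2`-box with a `1`-box: the top and the bottom of `z`, on the
right, are joined to the right string of `a`. -/
def convRight (h : η = !ε) (a : P.Box η 2) (z : P.Box η 1) : P.Box η 1 :=
  P.comp (P.tensor (shade_one_of' h) (P.ident η 1) (P.cup ε))
    (P.comp (P.tensor (b := 2) (d := 1) (shade_two η) a z)
      (P.tensor (shade_one_of' h) (P.ident η 1) (P.cap ε)))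

/-- `F`-positivity: the Fourier transform is positive. -/
def IsFPos (h : η = !ε) (x : P.Box ε 2) : Prop := IsPos (fourier h x)

/-- The spectral radius of an element of a box space. -/
def specRad (x : P.Box ε n) : ℝ := (spectralRadius ℂ x).toReal

/-- `E⁺`: the positive elements of `E = {y | y ∗ x̂ = r y}`, where `r` is the spectral radius of
`x`. -/
def eigenPos (h : η = !ε) (x : P.Box ε 2) : Set (P.Box ε 1) :=
  {y | convLeft h y (fourier h x) = (specRad x : ℂ) • y ∧ IsPos y}

/-- A right PF eigenvector of `x`: a nonzero positive `z` with `x̂ ∗ z = r z`. -/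
def IsRightPFEigenvector (h : η = !ε) (x : P.Box ε 2) (z : P.Box η 1) : Prop :=
  z ≠ 0 ∧ IsPos z ∧ convRight h (fourier h x) z = (specRad x : ℂ) • z

/-- `p` is the largest of the range projections of the elements of `E⁺`. -/
def IsMaxProj (h : η = !ε) (x : P.Box ε 2) (p : P.Box ε 1) : Prop :=
  (∃ y ∈ eigenPos h x, p = rangeProj y) ∧ ∀ y ∈ eigenPos h x, p * rangeProj y = rangeProj y

/-- The maximal projection `p_max`. -/
def pMax (h : η = !ε) (x : P.Box ε 2) : P.Box ε 1 := Classical.epsilon fun p => IsMaxProj h x p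

/-- The maximal-support PF eigenvector
`ζ = lim_{z → r⁺} (z - r) ∑ j, z ^ (-(j + 1)) (p_max ∗ x̂ ^ {∗ j})`. -/
def zeta (h : η = !ε) (x : P.Box ε 2) : P.Box ε 1 :=
  limUnder (𝓝[>] specRad x) fun z : ℝ =>
    ((z - specRad x : ℝ) : ℂ) •
      ∑' j : ℕ, (((z ^ (j + 1))⁻¹ : ℝ) : ℂ) •
        (fun y => convLeft h y (fourier h x))^[j] (pMax h x)

/-- The `2`-box with the `1`-box `y` on the left string and nothing on the right string. -/
def onLeft (h : η = !ε) (y : P.Box ε 1) : P.Box ε 2 :=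
  P.tensor (b := 1) (d := 1) (shade_one_of h) y (P.ident η 1)

/-- The `2`-box with nothing on the left string and the `1`-box `z` on the right string. -/
def onRight (h : η = !ε) (z : P.Box η 1) : P.Box ε 2 :=
  P.tensor (b := 1) (d := 1) (shade_one_of h) (P.ident ε 1) z

/-- The algebra `C` of all `y` such that `x` commutes with `y` placed on the left string and with
`ȳ` placed on the right string. -/
def exchange (h : η = !ε) (x : P.Box ε 2) : Set (P.Box ε 1) :=
  {y | x * onRight h (conj h y) = onRight h (conj h y) * x ∧
    x * onLeft h y = onLeft h y * x}

/-- `C⁺`: the positive elements of `C`. -/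
def exchangePos (h : η = !ε) (x : P.Box ε 2) : Set (P.Box ε 1) :=
  {y | y ∈ exchange h x ∧ IsPos y}

end CStarPlanarAlgebra

end

noncomputable section

set_option linter.unusedSectionVars false

/-! ### Functional calculus and range projections in a finite-dimensional C*-algebra. -/

namespace FiniteCStar

variable {A : Type*} [CStarAlgebra A] [FiniteDimensional ℂ A]

/-! Write `x̂ = z z*` and bend the lower left string of `z` to obtain a picture `V` with one lower
and three upper points. Such pictures form a bimodule over the `1`-boxes `A`, with an `A`-valued
inner product, and `S(a) = a ∗ x̂` equals `⟨V·a, V⟩`. Hence `S` is a positive map, `E⁺` is its cone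
of positive eigenvectors at `r`, and the statement becomes one about a vector in a correspondence.

`E⁺` contains an element `y₀` of largest support `p`. Since `p` is dominated by a multiple of `y₀`,
its orbit grows at most like `r ^ j`; the resolvent therefore has at most a simple pole at `r` on
`p`, and `ζ` exists. Since `p` also dominates a multiple of `y₀`, the support of `ζ` is exactly `p`
(`exists_tendsto_support`).

If `c` is in `C⁺`, isotopy gives `S(ca) = c S(a)` and `S(ac) = S(a) c`. Then `c y₀ c` lies in `E⁺`,
which forces `c` to commute with `p`, hence with every `S^j p`, hence with `ζ`; so `ζ c` is a
positive eigenvector (`mul_mem_eigenCone`).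

Conversely let `y` be in `E⁺` and put `c = ζ^(-1/2) y ζ^(-1/2)`. The right eigenvector `y₁` gives a
functional `φ`, with values in the `0`-boxes, that satisfies `φ ∘ S = r φ` and is faithful on `p`.
It forces equality in the Schwarz inequality for the fixed point `c` of the normalised map `a ↦ r⁻¹
ζ^(-1/2) S(ζ^(1/2) a ζ^(1/2)) ζ^(-1/2)` (for `r ≠ 0`), and equality means that `c` satisfies an
intertwining relation with `V`. The relation passes to the spectral projections `e` of `c`, so
`ζ^(1/2) e ζ^(1/2)` is in `E⁺` for those at nonzero eigenvalues; its range projection commutes with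
`ζ` by hypothesis, and this identifies it with `e`. Thus `c` commutes with `ζ`, `y = ζ c`, and `c·V
= V·c` (`exists_commuting_factor`). The last identity says that `c` slides along the strings of `z`,
which by isotopy puts `c` in `C` (`mem_exchange`). -/

theorem finite_spectrum_real (a : A) : (spectrum ℝ a).Finite := by
  have : FiniteDimensional ℝ A := FiniteDimensional.complexToReal A
  have hint : IsIntegral ℝ a := Algebra.IsIntegral.isIntegral a
  refine ((minpoly ℝ a).roots.toFinset.finite_toSet).subset fun l hl => ?_
  have h1 := spectrum.subset_polynomial_aeval a (minpoly ℝ a) ⟨l, hl, rfl⟩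
  rw [minpoly.aeval] at h1
  have h2 : (minpoly ℝ a).eval l = 0 := by
    have : Nontrivial A := by
      by_contra hn
      rw [not_nontrivial_iff_subsingleton] at hn
      simp at h1
    simpa using h1
  simpa [minpoly.ne_zero hint] using h2

theorem continuousOn_spectrum (f : ℝ → ℝ) (a : A) : ContinuousOn f (spectrum ℝ a) :=
  (finite_spectrum_real a).continuousOn f

theorem cfc_mul_cfc (f g : ℝ → ℝ) (a : A) :
    cfc f a * cfc g a = cfc (fun t => f t * g t) a :=
  (cfc_mul f g a (continuousOn_spectrum f a) (continuousOn_spectrum g a)).symm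

/-- Lagrange interpolation on the finite spectrum. It lets algebraic relations for `a` pass to its
spectral projections. -/
theorem exists_polynomial_cfc (f : ℝ → ℝ) {a : A} (ha : IsSelfAdjoint a) :
    ∃ q : Polynomial ℝ, cfc f a = Polynomial.aeval a q := by
  classical
  refine ⟨Lagrange.interpolate (finite_spectrum_real a).toFinset id f, ?_⟩
  rw [← cfc_polynomial _ a ha]
  refine cfc_congr fun t ht => ?_
  exact (Lagrange.eval_interpolate_at_node f (fun _ _ _ _ h => h)
    ((finite_spectrum_real a).mem_toFinset.2 ht)).symm

/-- `q` is the smallest projection with `q * y = y`. -/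
def IsRangeProjection (q y : A) : Prop :=
  IsStarProjection q ∧ q * y = y ∧ ∀ q' : A, IsStarProjection q' → q' * y = y → q' * q = q

theorem IsRangeProjection.unique {q q' y : A} (hq : IsRangeProjection q y)
    (hq' : IsRangeProjection q' y) : q = q' := by
  have h1 := hq.2.2 q' hq'.1 hq'.2.1
  have h2 := hq'.2.2 q hq.1 hq.2.1
  have h3 := congrArg star h1
  rw [star_mul, hq.1.isSelfAdjoint.star_eq, hq'.1.isSelfAdjoint.star_eq] at h3
  rw [← h3, h2]

/-- The spectral projection of `a` at the complement of `0`. -/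
def support (a : A) : A := cfc (fun t : ℝ => if t = 0 then 0 else 1) a

/-- The inverse of `a` on its support. -/
def pinv (a : A) : A := cfc (fun t : ℝ => t⁻¹) a

theorem isStarProjection_support (a : A) : IsStarProjection (support a) := by
  refine ⟨?_, cfc_predicate _ a⟩
  rw [IsIdempotentElem, support, cfc_mul_cfc]
  congr 1; ext t; split_ifs <;> simp

theorem support_mul {a : A} (ha : IsSelfAdjoint a) : support a * a = a := by
  have h : support a * cfc (fun t : ℝ => t) a = cfc (fun t : ℝ => t) a := by
    rw [support, cfc_mul_cfc]
    congr 1; ext t; split_ifs <;> simp_all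
  rwa [cfc_id' ℝ a] at h

theorem pinv_mul {a : A} (ha : IsSelfAdjoint a) : pinv a * a = support a := by
  conv_lhs => enter [2]; rw [← cfc_id' ℝ a]
  rw [pinv, cfc_mul_cfc, support]
  congr 1; ext t; split_ifs <;> simp_all

theorem mul_pinv {a : A} (ha : IsSelfAdjoint a) : a * pinv a = support a := by
  conv_lhs => enter [1]; rw [← cfc_id' ℝ a]
  rw [pinv, cfc_mul_cfc, support]
  congr 1; ext t; split_ifs <;> simp_all

theorem isRangeProjection_support {a : A} (ha : IsSelfAdjoint a) :
    IsRangeProjection (support a) a := by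
  refine ⟨isStarProjection_support a, support_mul ha, fun q' _ h => ?_⟩
  rw [← mul_pinv ha, ← mul_assoc, h]

theorem IsRangeProjection.exists_eq_mul {q y : A} (hy : IsSelfAdjoint y)
    (hq : IsRangeProjection q y) : ∃ g, q = y * g :=
  ⟨pinv y, by rw [mul_pinv hy, hq.unique (isRangeProjection_support hy)]⟩

theorem IsRangeProjection.exists_eq_mul' {q y : A} (hy : IsSelfAdjoint y)
    (hq : IsRangeProjection q y) : ∃ g, q = g * y :=
  ⟨pinv y, by rw [pinv_mul hy, hq.unique (isRangeProjection_support hy)]⟩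

theorem IsRangeProjection.mul_right {q y : A} (hy : IsSelfAdjoint y)
    (hq : IsRangeProjection q y) : y * q = y := by
  have := congrArg star hq.2.1
  rwa [star_mul, hq.1.isSelfAdjoint.star_eq, hy.star_eq] at this

variable [PartialOrder A] [StarOrderedRing A]

theorem nonneg_iff_exists {a : A} : 0 ≤ a ↔ ∃ b, a = b * star b := by
  rw [CStarAlgebra.nonneg_iff_eq_mul_star_self]

/-- The positive square root. -/
def root (a : A) : A := cfc Real.sqrt a

theorem isSelfAdjoint_root (a : A) : IsSelfAdjoint (root a) := cfc_predicate _ a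

theorem root_mul_root {a : A} (ha : 0 ≤ a) : root a * root a = a := by
  rw [root, cfc_mul_cfc]
  conv_rhs => rw [← cfc_id' ℝ a]
  refine cfc_congr fun t ht => ?_
  exact Real.mul_self_sqrt (spectrum_nonneg_of_nonneg ha ht)

/-- The inverse square root of `a` on its support. -/
def invRoot (a : A) : A := cfc (fun t : ℝ => (Real.sqrt t)⁻¹) a

theorem isSelfAdjoint_invRoot (a : A) : IsSelfAdjoint (invRoot a) := cfc_predicate _ a

theorem root_mul_invRoot {a : A} (ha : 0 ≤ a) : root a * invRoot a = support a := by
  rw [root, invRoot, cfc_mul_cfc, support]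
  refine cfc_congr fun t ht => ?_
  have := spectrum_nonneg_of_nonneg ha ht
  by_cases h : t = 0
  · simp [h]
  · have : Real.sqrt t ≠ 0 := (Real.sqrt_pos.2 (lt_of_le_of_ne this (Ne.symm h))).ne'
    simp [h, this]

theorem invRoot_mul_root {a : A} (ha : 0 ≤ a) : invRoot a * root a = support a := by
  rw [← root_mul_invRoot ha, root, invRoot]
  exact cfc_commute_cfc _ _ _

theorem commute_cfc {a b : A} (h : Commute a b) (ha : IsSelfAdjoint a) (f : ℝ → ℝ) :
    Commute (cfc f a) b := ha.commute_cfc h f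

theorem exists_smul_le_support {a : A} (ha : 0 ≤ a) :
    ∃ k : ℝ, 0 < k ∧ k • a ≤ support a := by
  obtain ⟨M, hM⟩ := (finite_spectrum_real a).bddAbove
  refine ⟨(|M| + 1)⁻¹, by positivity, ?_⟩
  have h : (|M| + 1)⁻¹ • cfc (fun t : ℝ => t) a ≤ support a := by
    rw [← cfc_smul (R := ℝ) _ _ a (continuousOn_spectrum _ _), support]
    refine cfc_mono (fun t ht => ?_) (continuousOn_spectrum _ _) (continuousOn_spectrum _ _)
    have h0 := spectrum_nonneg_of_nonneg ha ht
    by_cases h : t = 0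
    · simp [h]
    · rw [if_neg h, smul_eq_mul, inv_mul_le_iff₀ (by positivity)]
      linarith [hM ht, le_abs_self M]
  rwa [cfc_id' ℝ a] at h

theorem exists_support_le_smul {a : A} (ha : 0 ≤ a) :
    ∃ k : ℝ, 0 ≤ k ∧ support a ≤ k • a := by
  obtain ⟨M, hM⟩ := ((finite_spectrum_real a).image fun t => t⁻¹).bddAbove
  refine ⟨|M|, by positivity, ?_⟩
  have h : support a ≤ |M| • cfc (fun t : ℝ => t) a := by
    rw [← cfc_smul (R := ℝ) _ _ a (continuousOn_spectrum _ _), support]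
    refine cfc_mono (fun t ht => ?_) (continuousOn_spectrum _ _) (continuousOn_spectrum _ _)
    have h0 := spectrum_nonneg_of_nonneg ha ht
    by_cases h : t = 0
    · simp [h]
    · rw [if_neg h, smul_eq_mul, ← inv_le_iff_one_le_mul₀ (lt_of_le_of_ne h0 (Ne.symm h))]
      exact (hM ⟨t, ht, rfl⟩).trans (le_abs_self M)
  rwa [cfc_id' ℝ a] at h

/-- The hypothesis is `(a √y)(a √y)* = 0`, so `a √y = 0`. -/
theorem mul_eq_zero_of_mul_mul_star {a y : A} (hy : 0 ≤ y) (h : a * y * star a = 0) :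
    a * y = 0 := by
  have h1 : (a * root y) * star (a * root y) = 0 := by
    rw [star_mul, (isSelfAdjoint_root y).star_eq, mul_assoc, ← mul_assoc (root y),
      root_mul_root hy, ← mul_assoc, h]
  rw [CStarRing.mul_star_self_eq_zero_iff] at h1
  rw [← root_mul_root hy, ← mul_assoc, h1, zero_mul]

theorem exists_spectral_sum {c : A} (hc : IsSelfAdjoint c) :
    c = ∑ l ∈ (finite_spectrum_real c).toFinset, l • cfc (fun t => if t = l then (1 : ℝ) else 0) c := by
  conv_lhs => rw [← cfc_id' ℝ c]
  simp_rw [← cfc_smul (R := ℝ) _ _ c (continuousOn_spectrum _ _)]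
  rw [← cfc_sum _ _ _ (fun i _ => continuousOn_spectrum _ _)]
  refine cfc_congr fun t ht => ?_
  simp [Finset.sum_apply, ht]

end FiniteCStar

/-! ### Correspondences and the commuting factor of an eigenvector. -/

namespace FiniteCStar
open MulOpposite

variable {A : Type*} [CStarAlgebra A]
variable {H : Type*} [AddCommGroup H] [Module A H] [Module Aᵐᵒᵖ H]

/-- `ip` makes the `A`-`A`-bimodule `H` a correspondence, with inner products that are linear over
the left action. -/
structure IsCorrespondence (ip : H → H → A) : Prop where
  add_left : ∀ v w u, ip (v + w) u = ip v u + ip w u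
  smul_left : ∀ (a : A) v w, ip (a • v) w = a * ip v w
  star_ip : ∀ v w, star (ip v w) = ip w v
  op_smul_left : ∀ (a : A) v w, ip (op a • v) w = ip v (op (star a) • w)
  nonneg : ∀ v, ∃ b, ip v v = b * star b
  definite : ∀ v, ip v v = 0 → v = 0

namespace IsCorrespondence

variable {ip : H → H → A} (hip : IsCorrespondence ip)
include hip

theorem smul_right (a : A) (v w : H) : ip v (a • w) = ip v w * star a := by
  rw [← hip.star_ip, hip.smul_left, star_mul, hip.star_ip]

theorem add_right (v w u : H) : ip v (w + u) = ip v w + ip v u := by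
  rw [← hip.star_ip, hip.add_left, star_add, hip.star_ip, hip.star_ip]

theorem neg_left (v w : H) : ip (-v) w = - ip v w := by
  rw [← neg_one_smul A v, hip.smul_left, neg_one_mul]

theorem neg_right (v w : H) : ip v (-w) = - ip v w := by
  rw [← hip.star_ip, hip.neg_left, star_neg, hip.star_ip]

theorem sub_left (v w u : H) : ip (v - w) u = ip v u - ip w u := by
  rw [sub_eq_add_neg, hip.add_left, hip.neg_left, sub_eq_add_neg]

theorem sub_right (v w u : H) : ip v (w - u) = ip v w - ip v u := by
  rw [sub_eq_add_neg, hip.add_right, hip.neg_right, sub_eq_add_neg]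

theorem ip_op_op (a b : A) (v w : H) : ip (op a • v) (op b • w) = ip (op (a * star b) • v) w := by
  rw [op_mul, mul_smul, hip.op_smul_left (star b), star_star]

end IsCorrespondence

variable [Module ℂ H] [IsScalarTower ℂ A H] [IsScalarTower ℂ Aᵐᵒᵖ H] [SMulCommClass A Aᵐᵒᵖ H]
variable [FiniteDimensional ℂ A] [PartialOrder A] [StarOrderedRing A]

/-- An intertwining relation for `c` passes to the polynomials in `c`. -/
theorem intertwine_aeval {V : H} {s t c : A} (ht : t * s * c = c)
    (h1 : op s • V = (s * t) • op s • V)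
    (h : op (s * c) • V = (s * c * t) • op s • V) (q : Polynomial ℝ) :
    op (s * Polynomial.aeval c q) • V = (s * Polynomial.aeval c q * t) • op s • V := by
  have := SMulCommClass.symm A Aᵐᵒᵖ H
  induction q using Polynomial.induction_on' with
  | add p q hp hq =>
    rw [map_add, mul_add, op_add, add_smul, hp, hq, add_mul, add_smul]
  | monomial n a =>
    have key : op (s * c ^ n) • V = (s * c ^ n * t) • op s • V := by
      induction n with
      | zero => simpa using h1
      | succ n ih =>
        rw [pow_succ, ← mul_assoc, op_mul, mul_smul, ih, smul_comm, ← mul_smul (op c), ← op_mul, h,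
          ← mul_smul]
        congr 1
        have : t * (s * c) = c := by rw [← mul_assoc, ht]
        simp only [mul_assoc] at this ⊢
        rw [← mul_assoc t s, ← mul_assoc (t * s), ht]
    have e : s * Polynomial.aeval c (Polynomial.monomial n a) = (a : ℂ) • (s * c ^ n) := by
      rw [Polynomial.aeval_monomial, Algebra.algebraMap_eq_smul_one, smul_mul_assoc, one_mul,
        mul_smul_comm]
      exact (Complex.coe_smul a _).symm
    rw [e, op_smul, smul_assoc, key, smul_mul_assoc, smul_assoc]

/-- The factor is `c = t y t` with `s = ζ^(1/2)` and `t = ζ^(-1/2)` on the support `p`. The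
invariant functional `φ`, faithful on `p`, turns the Schwarz inequality for `c` into an equality;
the commutation hypothesis is then applied to the eigenvectors `s e s`, where `e` is a spectral
projection of `c`. -/
theorem exists_commuting_factor {ip : H → H → A} (hip : IsCorrespondence ip) {V : H}
    {S : A →ₗ[ℂ] A} (hS : ∀ a, S a = ip (op a • V) V) {r : ℝ}
    {K : Type*} [AddCommGroup K] [Module ℂ K] {φ : A →ₗ[ℂ] K} (hφS : ∀ a, φ (S a) = (r : ℂ) • φ a)
    {p : A} (hφp : ∀ a, φ (a * p) = φ a) (hφ : ∀ a, φ (a * star a) = 0 → p * a = 0)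
    {ζ : A} (hζ : 0 ≤ ζ) (hSζ : S ζ = (r : ℂ) • ζ) (hpζ : IsRangeProjection p ζ)
    (hcomm : ∀ y, 0 ≤ y → S y = (r : ℂ) • y → ∀ q, IsRangeProjection q y → Commute ζ q)
    {y : A} (hy : 0 ≤ y) (hSy : S y = (r : ℂ) • y) (hpy : p * y = y) :
    ∃ c, 0 ≤ c ∧ ζ * c = y ∧ c • V = op c • V := by
  have := SMulCommClass.symm A Aᵐᵒᵖ H
  have hpp : p * p = p := hpζ.1.isIdempotentElem
  have hps : star p = p := hpζ.1.isSelfAdjoint.star_eq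
  have hp : p = support ζ := hpζ.unique (isRangeProjection_support (.of_nonneg hζ))
  obtain ⟨s, hs⟩ : ∃ s, s = root ζ := ⟨_, rfl⟩
  obtain ⟨t, ht⟩ : ∃ t, t = invRoot ζ := ⟨_, rfl⟩
  have hss : s * s = ζ := by rw [hs, root_mul_root hζ]
  have hst : s * t = p := by rw [hs, ht, hp, root_mul_invRoot hζ]
  have hts : t * s = p := by rw [hs, ht, hp, invRoot_mul_root hζ]
  have hsa : star s = s := by rw [hs]; exact isSelfAdjoint_root ζ
  have hta : star t = t := by rw [ht]; exact isSelfAdjoint_invRoot ζ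
  have hpsup : p * s = s := by
    have : (1 - p) * ζ = 0 := by rw [sub_mul, one_mul, hpζ.2.1, sub_self]
    have h0 : ((1 - p) * s) * star ((1 - p) * s) = 0 := by
      rw [star_mul, hsa, mul_assoc, ← mul_assoc s, hss, ← mul_assoc, this, zero_mul]
    rw [CStarRing.mul_star_self_eq_zero_iff, sub_mul, one_mul, sub_eq_zero] at h0
    exact h0.symm
  have hsp : s * p = s := by simpa [hsa, hps] using congrArg star hpsup
  have hpt : p * t = t := by
    have h0 : support ζ * invRoot ζ = invRoot ζ := by
      rw [support, invRoot, cfc_mul_cfc]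
      congr 1; ext l; by_cases h : l = 0 <;> simp [h]
    rwa [← hp, ← ht] at h0
  have htp : t * p = t := by simpa [hta, hps] using congrArg star hpt
  have hyp : y * p = y := by simpa [hps, (IsSelfAdjoint.of_nonneg hy).star_eq] using congrArg star hpy
  -- the support of `ζ` reduces `V`
  have hVs : p • op s • V = op s • V := by
    have h0 : op s • V - p • op s • V = 0 := by
      have e : op s • V - p • op s • V = (1 - p) • op s • V := by rw [sub_smul, one_smul]
      apply hip.definite
      rw [e, hip.smul_left, hip.smul_right, hip.ip_op_op, hsa, hss, ← hS, hSζ, smul_mul_assoc,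
        mul_smul_comm, ← mul_assoc, sub_mul 1 p ζ, one_mul, hpζ.2.1, sub_self, zero_mul, smul_zero]
    exact (sub_eq_zero.1 h0).symm
  have hVp : p • op p • V = op p • V := by
    have := congrArg (fun v => op t • v) hVs
    simp only [smul_comm (op t) p, ← mul_smul (op t), ← op_mul, hst] at this
    exact this
  -- Invariance gives `φ(S(1 - p)) = r φ(1 - p) = 0`, and `S(1 - p)` is the square of `V·(1 - p)`;
  -- faithfulness of `φ` on `p` kills `p·V·(1 - p)`.
  have hVq : p • op p • V = p • V := by
    have h0 : φ (S (1 - p)) = 0 := by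
      rw [hφS, ← hφp, sub_mul, one_mul, hpp, sub_self, map_zero, smul_zero]
    have e : S (1 - p) = ip (op (1 - p) • V) (op (1 - p) • V) := by
      rw [hip.ip_op_op, hS, star_sub, star_one, hps, mul_sub, mul_one, sub_mul, one_mul, hpp,
        sub_self, sub_zero]
    obtain ⟨b, hb⟩ := hip.nonneg (op (1 - p) • V)
    have h1 : p * b = 0 := hφ b (by rw [← hb, ← e, h0])
    have h2 : p • op (1 - p) • V = 0 := by
      apply hip.definite
      rw [hip.smul_left, hip.smul_right, hb, ← mul_assoc, ← mul_assoc, h1, zero_mul, zero_mul]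
    rw [op_sub, op_one, sub_smul, one_smul, smul_sub, sub_eq_zero] at h2
    exact h2.symm
  -- the relative density of `y`
  obtain ⟨c, hc⟩ : ∃ c, c = t * y * t := ⟨_, rfl⟩
  have hc0 : 0 ≤ c := by
    have := star_right_conjugate_nonneg hy t
    rwa [hta, ← hc] at this
  have hca : star c = c := (IsSelfAdjoint.of_nonneg hc0).star_eq
  have hpc : p * c = c := by rw [hc, ← mul_assoc, ← mul_assoc, hpt]
  have hcp : c * p = c := by rw [hc, mul_assoc, htp]
  have hscs : s * c * s = y := by
    rw [hc]
    calc s * (t * y * t) * s = (s * t) * y * (t * s) := by simp only [mul_assoc]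
      _ = y := by rw [hst, hts, hpy, hyp]
  -- Equality in the Schwarz inequality: since `S ζ = r ζ` and `S (s c s) = r s c s`, the square of
  -- the difference is `S(s c² s) - r s c² s`, which `φ` annihilates. The difference is fixed by `p`
  -- on the left, where `φ` is faithful.
  have hF : op (s * c) • V = (s * c * t) • op s • V := by
    rw [← sub_eq_zero]
    apply hip.definite
    obtain ⟨b, hb⟩ := hip.nonneg (op (s * c) • V - (s * c * t) • op s • V)
    have e1 : ip (op (s * c) • V) (op (s * c) • V) = S (s * c * c * s) := by
      rw [hip.ip_op_op, hS, star_mul, hca, hsa]; simp only [mul_assoc]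
    have e2 : ip (op (s * c) • V) ((s * c * t) • op s • V) = (r : ℂ) • (s * c * c * s) := by
      rw [hip.smul_right, hip.ip_op_op, hsa, hscs, ← hS, hSy, smul_mul_assoc]
      congr 1
      rw [star_mul, star_mul, hta, hca, hsa, ← hscs]
      calc s * c * s * (t * (c * s)) = s * c * (s * t) * c * s := by simp only [mul_assoc]
        _ = s * c * c * s := by rw [hst, mul_assoc s c p, hcp]
    have e3 : ip ((s * c * t) • op s • V) (op (s * c) • V) = (r : ℂ) • (s * c * c * s) := by
      rw [← hip.star_ip, e2, star_smul]
      simp [hsa, hca, mul_assoc]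
    have e4 : ip ((s * c * t) • op s • V) ((s * c * t) • op s • V) = (r : ℂ) • (s * c * c * s) := by
      rw [hip.smul_right, hip.smul_left, hip.ip_op_op, hsa, hss, ← hS, hSζ, mul_smul_comm,
        smul_mul_assoc]
      congr 1
      rw [star_mul, star_mul, hta, hca, hsa, ← hss]
      calc s * c * t * (s * s) * (t * (c * s)) = s * c * (t * s) * (s * t) * c * s := by
            simp only [mul_assoc]
        _ = s * c * c * s := by rw [hst, hts, mul_assoc s c p, hcp, mul_assoc s c p, hcp]
    have e5 : ip (op (s * c) • V - (s * c * t) • op s • V)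
        (op (s * c) • V - (s * c * t) • op s • V) =
          S (s * c * c * s) - (r : ℂ) • (s * c * c * s) := by
      rw [hip.sub_left, hip.sub_right, hip.sub_right, e1, e2, e3, e4]; abel
    have h1 : p * b = 0 := by
      apply hφ
      rw [← hb, e5, map_sub, hφS, map_smul, sub_self]
    have h2 : p • (op (s * c) • V - (s * c * t) • op s • V) =
        op (s * c) • V - (s * c * t) • op s • V := by
      rw [smul_sub, ← mul_smul, ← mul_assoc, ← mul_assoc, hpsup]
      congr 1
      rw [op_mul, mul_smul, smul_comm, hVs]
    rw [← h2, hip.smul_left, hip.smul_right, hb, ← mul_assoc, ← mul_assoc, h1, zero_mul, zero_mul]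
  have hVst : op s • V = (s * t) • op s • V := by rw [hst, hVs]
  -- It suffices that each spectral projection of `c` at a nonzero eigenvalue commutes with `s`; the
  -- projection at `0` does not contribute to the sum, and it need not lie under `p`.
  have hCs : Commute c s := by
    rw [exists_spectral_sum (c := c) hca]
    refine Commute.sum_left _ _ _ fun l _ => ?_
    by_cases hl : l = 0
    · rw [hl, zero_smul]; exact Commute.zero_left s
    refine Commute.smul_left ?_ l
    obtain ⟨e, he⟩ : ∃ e, e = cfc (fun t : ℝ => if t = l then (1 : ℝ) else 0) c := ⟨_, rfl⟩
    rw [← he]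
    have hee : e * e = e := by
      rw [he, cfc_mul_cfc]
      congr 1; ext t; split_ifs <;> simp
    have hea : star e = e := by rw [he]; exact cfc_predicate (R := ℝ) _ c
    obtain ⟨g, hg⟩ : ∃ g, e = c * g := by
      refine ⟨l⁻¹ • e, ?_⟩
      have h : cfc (fun t : ℝ => t) c * e = l • e := by
        rw [he, cfc_mul_cfc, ← cfc_smul (R := ℝ) _ _ c (continuousOn_spectrum _ _)]
        congr 1; ext t; split_ifs with h <;> simp [h]
      rw [cfc_id' ℝ c (show IsSelfAdjoint c from hca)] at h
      rw [mul_smul_comm, h, smul_smul, inv_mul_cancel₀ hl, one_smul]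
    have hpe : p * e = e := by rw [hg, ← mul_assoc, hpc]
    have hep : e * p = e := by simpa [hps, hea] using congrArg star hpe
    obtain ⟨f, hf⟩ := exists_polynomial_cfc (fun t : ℝ => if t = l then (1 : ℝ) else 0) (a := c) hca
    have hVe := intertwine_aeval (by rw [hts, hpc]) hVst hF f
    rw [← hf, ← he] at hVe
    -- The intertwining relation for `e` moves `e` out of the inner product and leaves `S ζ = r ζ`.
    have hSe : S (s * e * s) = (r : ℂ) • (s * e * s) := by
      have h0 : S (s * e * s) = ip (op (s * e) • V) (op s • V) := by
        rw [hip.ip_op_op, hS, hsa]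
      rw [h0, hVe, hip.smul_left, hip.ip_op_op, hsa, hss, ← hS, hSζ, mul_smul_comm, ← hss,
        mul_assoc (s * e), ← mul_assoc t, hts, hpsup]
    have hse0 : 0 ≤ s * e * s := by
      have := star_mul_self_nonneg (e * s)
      rwa [star_mul, hsa, hea, mul_assoc, ← mul_assoc e, hee, ← mul_assoc] at this
    have hq := isRangeProjection_support (IsSelfAdjoint.of_nonneg hse0)
    obtain ⟨q, hqdef⟩ : ∃ q, q = support (s * e * s) := ⟨_, rfl⟩
    rw [← hqdef] at hq
    have hζq := hcomm _ hse0 hSe q hq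
    have hsq : s * q = q * s := by rw [hs]; exact commute_cfc hζq (.of_nonneg hζ) _
    have htq : t * q = q * t := by rw [ht]; exact commute_cfc hζq (.of_nonneg hζ) _
    have hpq : p * q = q := hq.2.2 p hpζ.1 (by rw [← mul_assoc, ← mul_assoc, hpsup])
    have hqp : q * p = q := by simpa [hps, hq.1.isSelfAdjoint.star_eq] using congrArg star hpq
    -- Since `q` commutes with `s` and `t`, it can be carried past the factors that undo the
    -- conjugation `e ↦ s e s`. So `q` and `e` each absorb the other, and they coincide.
    have hqe : q * e = e := by
      calc q * e = p * q * e := by rw [hpq]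
        _ = t * (s * q) * e := by rw [← hts]; simp only [mul_assoc]
        _ = t * (q * (s * e * s)) * t := by
          rw [hsq]
          calc t * (q * s) * e = t * (q * s) * (e * p) := by rw [hep]
            _ = _ := by rw [← hst]; simp only [mul_assoc]
        _ = (t * s) * e * (s * t) := by rw [hq.2.1]; simp only [mul_assoc]
        _ = e := by rw [hts, hst, hpe, hep]
    have heq : e * q = q := by
      obtain ⟨g', hg'⟩ := hq.exists_eq_mul (.of_nonneg hse0)
      have h1 : e * (t * q) = t * q := by
        rw [hg']
        calc e * (t * (s * e * s * g')) = e * (t * s) * e * s * g' := by simp only [mul_assoc]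
          _ = (t * s) * e * s * g' := by rw [hts, hep, hee, hpe]
          _ = t * (s * e * s * g') := by simp only [mul_assoc]
      rw [htq, ← mul_assoc] at h1
      have h2 := congrArg (· * s) h1
      simp only [mul_assoc, hts, hqp] at h2
      exact h2
    have : q = e := by
      rw [← heq]
      simpa [hea, hq.1.isSelfAdjoint.star_eq] using congrArg star hqe
    rw [← this]
    exact hsq.symm
  refine ⟨c, hc0, ?_, ?_⟩
  · rw [← hscs, ← hss, mul_assoc, ← hCs.eq, ← mul_assoc, ← hCs.eq, mul_assoc]
  · have h1 : op c • V = c • op p • V := by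
      have h2 : op (s * c) • V = c • op s • V := by
        rw [hF, ← hCs.eq, mul_assoc, hst, hcp]
      have h3 := congrArg (fun v => op t • v) h2
      rw [← hCs.eq] at h3
      simp only [smul_comm (op t) c, ← mul_smul (op t), ← op_mul, hst] at h3
      rwa [mul_assoc, hst, hcp] at h3
    rw [h1]
    calc c • V = c • p • V := by rw [← mul_smul, hcp]
      _ = c • op p • V := by rw [← hVq, ← mul_smul, hcp]

end FiniteCStar

/-! ### The pole of the resolvent at `r`. -/

section Resolvent

variable {E : Type*} [NormedAddCommGroup E] [NormedSpace ℂ E]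

/-- The Neumann series of the resolvent of `S` at `z`, applied to `a`. -/
def neumann (S : E →ₗ[ℂ] E) (z : ℝ) (a : E) : E :=
  ∑' j : ℕ, (((z ^ (j + 1))⁻¹ : ℝ) : ℂ) • S^[j] a

/-- The vectors whose orbit under `S` grows at most like `r ^ j`. -/
def growthSubmodule (S : E →ₗ[ℂ] E) (r : ℝ) : Submodule ℂ E where
  carrier := {a | ∃ C : ℝ, ∀ j : ℕ, ‖S^[j] a‖ ≤ C * r ^ j}
  zero_mem' := ⟨0, fun j => by simp⟩
  add_mem' := by
    rintro a b ⟨C, hC⟩ ⟨D, hD⟩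
    refine ⟨C + D, fun j => ?_⟩
    rw [iterate_map_add, add_mul]
    exact (norm_add_le _ _).trans (add_le_add (hC j) (hD j))
  smul_mem' := by
    rintro c a ⟨C, hC⟩
    refine ⟨‖c‖ * C, fun j => ?_⟩
    rw [← Module.End.pow_apply, map_smul, Module.End.pow_apply, norm_smul, mul_assoc]
    exact mul_le_mul_of_nonneg_left (hC j) (norm_nonneg c)

variable {S : E →ₗ[ℂ] E} {r : ℝ}

theorem apply_mem_growthSubmodule {a : E} (ha : a ∈ growthSubmodule S r) :
    S a ∈ growthSubmodule S r := by
  obtain ⟨C, hC⟩ := ha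
  refine ⟨C * r, fun j => ?_⟩
  rw [← Function.iterate_succ_apply]
  exact (hC (j + 1)).trans_eq (by ring)

theorem hasSum_geometric_resolvent (hr : 0 ≤ r) {z : ℝ} (hz : r < z) :
    HasSum (fun j : ℕ => (z ^ (j + 1))⁻¹ * r ^ j) (z - r)⁻¹ := by
  have hz0 : 0 < z := hr.trans_lt hz
  have h := (hasSum_geometric_of_lt_one (r := r / z) (by positivity)
    ((div_lt_one hz0).2 hz)).mul_left z⁻¹
  have e : z⁻¹ * (1 - r / z)⁻¹ = (z - r)⁻¹ := by
    rw [← mul_inv, mul_sub, mul_one, mul_div_cancel₀ _ hz0.ne']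
  rw [e] at h
  have e' : (fun j : ℕ => (z ^ (j + 1))⁻¹ * r ^ j) = fun j : ℕ => z⁻¹ * (r / z) ^ j := by
    funext j
    rw [div_pow, pow_succ, mul_inv, mul_comm (z ^ j)⁻¹, div_eq_mul_inv]
    ring
  rw [e']
  exact h

theorem norm_term_le {C : ℝ} {a : E} (hC : ∀ j : ℕ, ‖S^[j] a‖ ≤ C * r ^ j) {z : ℝ} (hz0 : 0 < z)
    (j : ℕ) : ‖(((z ^ (j + 1))⁻¹ : ℝ) : ℂ) • S^[j] a‖ ≤ C * ((z ^ (j + 1))⁻¹ * r ^ j) := by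
  rw [norm_smul, Complex.norm_real, Real.norm_of_nonneg (by positivity)]
  calc (z ^ (j + 1))⁻¹ * ‖S^[j] a‖ ≤ (z ^ (j + 1))⁻¹ * (C * r ^ j) :=
        mul_le_mul_of_nonneg_left (hC j) (by positivity)
    _ = _ := by ring

variable [FiniteDimensional ℂ E]

theorem summable_neumann (hr : 0 ≤ r) {a : E} (ha : a ∈ growthSubmodule S r) {z : ℝ} (hz : r < z) :
    Summable fun j : ℕ => (((z ^ (j + 1))⁻¹ : ℝ) : ℂ) • S^[j] a := by
  have : CompleteSpace E := FiniteDimensional.complete ℂ E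
  obtain ⟨C, hC⟩ := ha
  exact Summable.of_norm_bounded ((hasSum_geometric_resolvent hr hz).summable.mul_left C)
    (norm_term_le hC (hr.trans_lt hz))

theorem norm_smul_neumann_le (hr : 0 ≤ r) {C : ℝ} {a : E} (hC : ∀ j : ℕ, ‖S^[j] a‖ ≤ C * r ^ j)
    {z : ℝ} (hz : r < z) : ‖((z - r : ℝ) : ℂ) • neumann S z a‖ ≤ C := by
  have h1 : ‖neumann S z a‖ ≤ C * (z - r)⁻¹ :=
    tsum_of_norm_bounded ((hasSum_geometric_resolvent hr hz).mul_left C)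
      (norm_term_le hC (hr.trans_lt hz))
  have hzr : 0 < z - r := sub_pos.2 hz
  rw [norm_smul, Complex.norm_real, Real.norm_of_nonneg hzr.le]
  calc (z - r) * ‖neumann S z a‖ ≤ (z - r) * (C * (z - r)⁻¹) :=
        mul_le_mul_of_nonneg_left h1 hzr.le
    _ = C := by field_simp

theorem neumann_add (hr : 0 ≤ r) {a b : E} (ha : a ∈ growthSubmodule S r)
    (hb : b ∈ growthSubmodule S r) {z : ℝ} (hz : r < z) :
    neumann S z (a + b) = neumann S z a + neumann S z b := by
  unfold neumann
  rw [← (summable_neumann hr ha hz).tsum_add (summable_neumann hr hb hz)]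
  simp only [iterate_map_add, smul_add]

theorem smul_neumann_of_eigen (hr : 0 ≤ r) {a : E} (ha : S a = (r : ℂ) • a) {z : ℝ} (hz : r < z) :
    ((z - r : ℝ) : ℂ) • neumann S z a = a := by
  have hj : ∀ j : ℕ, S^[j] a = ((r ^ j : ℝ) : ℂ) • a := by
    intro j
    induction j with
    | zero => simp
    | succ j ih =>
      rw [Function.iterate_succ_apply', ih, map_smul, ha, smul_smul]
      congr 1; push_cast; ring
  have h : HasSum (fun j : ℕ => (((z ^ (j + 1))⁻¹ : ℝ) : ℂ) • S^[j] a)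
      ((((z - r)⁻¹ : ℝ) : ℂ) • a) := by
    convert (Complex.hasSum_ofReal.2 (hasSum_geometric_resolvent hr hz)).smul_const a using 2 with j
    rw [hj, smul_smul, Complex.ofReal_mul]
  rw [neumann, h.tsum_eq, smul_smul, ← Complex.ofReal_mul, mul_inv_cancel₀ (sub_pos.2 hz).ne',
    Complex.ofReal_one, one_smul]

/-- Shifting the series by one term gives `R(z) S a = z R(z) a - a`. -/
theorem neumann_apply_sub (hr : 0 ≤ r) {a : E} (ha : a ∈ growthSubmodule S r) {z : ℝ}
    (hz : r < z) : neumann S z (S a - (r : ℂ) • a) = ((z - r : ℝ) : ℂ) • neumann S z a - a := by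
  have hz0 : 0 < z := hr.trans_lt hz
  have hs := summable_neumann hr ha hz
  have h1 : neumann S z (S a) = (z : ℂ) • neumann S z a - a := by
    have h := hs.tsum_eq_zero_add
    have e : (z : ℂ) • neumann S z a = a + neumann S z (S a) := by
      rw [neumann, h, smul_add, smul_smul, neumann, ← tsum_const_smul'']
      congr 1
      · simp [hz0.ne']
      · refine tsum_congr fun j => ?_
        rw [smul_smul, Function.iterate_succ_apply, ← Complex.ofReal_mul]
        congr 2
        rw [pow_succ z (j + 1)]
        field_simp
    rw [e]; abel
  have h2 : neumann S z (-((r : ℂ) • a)) = -((r : ℂ) • neumann S z a) := by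
    rw [neumann, neumann, ← tsum_const_smul'', ← tsum_neg]
    refine tsum_congr fun j => ?_
    rw [← Module.End.pow_apply, map_neg, map_smul, smul_neg, smul_comm, Module.End.pow_apply]
  rw [sub_eq_add_neg, neumann_add hr (apply_mem_growthSubmodule ha)
    (neg_mem (Submodule.smul_mem _ _ ha)) hz, h1, h2, Complex.ofReal_sub, sub_smul]
  abel

/-- On vectors of growth `r ^ j` the resolvent has at most a simple pole at `r`. -/
theorem exists_tendsto_neumann (hr : 0 ≤ r) {a : E} (ha : a ∈ growthSubmodule S r) :
    ∃ b, Tendsto (fun z : ℝ => ((z - r : ℝ) : ℂ) • neumann S z a) (𝓝[>] r) (𝓝 b) ∧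
      S b = (r : ℂ) • b := by
  let W := growthSubmodule S r
  have hN : ∀ w ∈ W, (S - (r : ℂ) • (LinearMap.id : E →ₗ[ℂ] E)) w ∈ W := fun w hw =>
    sub_mem (apply_mem_growthSubmodule hw) (Submodule.smul_mem _ _ hw)
  let N : W →ₗ[ℂ] W := (S - (r : ℂ) • (LinearMap.id : E →ₗ[ℂ] E)).restrict hN
  have hNc : ∀ w : W, (N w : E) = S w - (r : ℂ) • (w : E) := fun w => rfl
  -- A nonzero `d = N w` in the kernel would be a Jordan block, so `S^(j+1) w` would contain `(j +
  -- 1) r^j d`, which outgrows `r ^ (j + 1)`. For `r = 0` the bound at `j = 0` already gives `d =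
  -- 0`.
  have hdis : Disjoint (LinearMap.ker N) (LinearMap.range N) := by
    rw [Submodule.disjoint_def]
    rintro _ hk ⟨w, rfl⟩
    obtain ⟨d, hd⟩ : ∃ d : E, d = (N w : E) := ⟨_, rfl⟩
    have hSd : S d = (r : ℂ) • d := by
      have := congrArg Subtype.val (LinearMap.mem_ker.1 hk)
      rw [hNc, ← hd] at this
      exact sub_eq_zero.1 this
    have hSw : S (w : E) = (r : ℂ) • (w : E) + d := by rw [hd, hNc]; abel
    have hit : ∀ j : ℕ, S^[j + 1] (w : E) =
        ((r ^ (j + 1) : ℝ) : ℂ) • (w : E) + (((j + 1) * r ^ j : ℝ) : ℂ) • d := by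
      intro j
      induction j with
      | zero => simp [hSw]
      | succ j ih =>
        rw [Function.iterate_succ_apply', ih, map_add, map_smul, map_smul, hSw, hSd, smul_add,
          smul_smul, smul_smul, add_assoc, ← add_smul]
        congr 2 <;> · push_cast; ring
    obtain ⟨C, hC⟩ := w.2
    have hbd : ∀ j : ℕ, (j + 1) * r ^ j * ‖d‖ ≤ (C + ‖(w : E)‖) * r ^ (j + 1) := by
      intro j
      have h1 : (((j + 1) * r ^ j : ℝ) : ℂ) • d =
          S^[j + 1] (w : E) - ((r ^ (j + 1) : ℝ) : ℂ) • (w : E) := by rw [hit]; abel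
      have h2 := congrArg norm h1
      rw [norm_smul, Complex.norm_real, Real.norm_of_nonneg (by positivity)] at h2
      rw [h2]
      refine (norm_sub_le _ _).trans ?_
      rw [norm_smul, Complex.norm_real, Real.norm_of_nonneg (by positivity)]
      linarith [hC (j + 1)]
    have hd0 : ‖d‖ = 0 := by
      rcases hr.eq_or_lt with h0 | h0
      · have := hbd 0
        simp [← h0] at this
        simp [this]
      · by_contra hne
        have hpos : 0 < ‖d‖ := lt_of_le_of_ne (norm_nonneg d) (Ne.symm hne)
        obtain ⟨n, hn⟩ := exists_nat_gt ((C + ‖(w : E)‖) * r / ‖d‖)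
        have h1 := hbd n
        rw [div_lt_iff₀ hpos] at hn
        have h2 : 0 < r ^ n := by positivity
        have h3 : (n + 1) * ‖d‖ * r ^ n ≤ (C + ‖(w : E)‖) * r * r ^ n := by
          rw [pow_succ] at h1; linarith
        have h4 := le_of_mul_le_mul_right h3 h2
        linarith
    exact Subtype.ext (by rw [← hd]; exact norm_eq_zero.1 hd0)
  have htop : LinearMap.ker N ⊔ LinearMap.range N = ⊤ := by
    refine Submodule.eq_top_of_disjoint _ _ ?_ hdis
    rw [add_comm, LinearMap.finrank_range_add_finrank_ker]
  have ha' : (⟨a, ha⟩ : W) ∈ LinearMap.ker N ⊔ LinearMap.range N := htop ▸ Submodule.mem_top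
  obtain ⟨b, hb, _, ⟨w, rfl⟩, hbw⟩ := Submodule.mem_sup.1 ha'
  have hSb : S (b : E) = (r : ℂ) • (b : E) := by
    have := congrArg Subtype.val (LinearMap.mem_ker.1 hb)
    rw [hNc] at this
    exact sub_eq_zero.1 this
  refine ⟨b, ?_, hSb⟩
  have hab : a = b + (S w - (r : ℂ) • (w : E)) := by
    have := congrArg Subtype.val hbw
    simpa [hNc] using this.symm
  -- With `a = b + N w` and `N b = 0`, the scaled resolvent fixes `b`, and it sends `N w` to `z - r`
  -- times a bounded vector. The limit is the kernel component `b`.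
  have heq : ∀ z ∈ Set.Ioi r, (b : E) + ((z - r : ℝ) : ℂ) • (((z - r : ℝ) : ℂ) • neumann S z (w : E) - w)
      = ((z - r : ℝ) : ℂ) • neumann S z a := by
    intro z hz
    conv_rhs => rw [hab]
    rw [neumann_add hr b.2 (show S w - (r : ℂ) • (w : E) ∈ growthSubmodule S r from hN w w.2) hz,
      smul_add, smul_neumann_of_eigen hr hSb hz,
      neumann_apply_sub hr w.2 hz]
  refine Tendsto.congr' (eventually_nhdsWithin_of_forall heq) ?_
  obtain ⟨C, hC⟩ := w.2
  have h0 : Tendsto (fun z : ℝ => ((z - r : ℝ) : ℂ)) (𝓝[>] r) (𝓝 0) := by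
    have : Tendsto (fun z : ℝ => ((z - r : ℝ) : ℂ)) (𝓝 r) (𝓝 ((r - r : ℝ) : ℂ)) :=
      (Continuous.tendsto (by fun_prop) r)
    rw [sub_self, Complex.ofReal_zero] at this
    exact this.mono_left nhdsWithin_le_nhds
  have h1 : Tendsto (fun z : ℝ => ((z - r : ℝ) : ℂ) •
      (((z - r : ℝ) : ℂ) • neumann S z (w : E) - w)) (𝓝[>] r) (𝓝 0) := by
    refine squeeze_zero_norm' (a := fun z : ℝ => ‖((z - r : ℝ) : ℂ)‖ * (C + ‖(w : E)‖)) ?_ ?_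
    · refine eventually_nhdsWithin_of_forall fun z hz => ?_
      rw [norm_smul]
      refine mul_le_mul_of_nonneg_left ?_ (norm_nonneg _)
      exact (norm_sub_le _ _).trans (by linarith [norm_smul_neumann_le hr hC hz])
    · simpa using h0.norm.mul_const (C + ‖(w : E)‖)
  simpa using h1.const_add (b : E)

theorem mem_of_tendsto_neumann {a b : E} (K : Submodule ℂ E) (hK : ∀ j : ℕ, S^[j] a ∈ K)
    (h : Tendsto (fun z : ℝ => ((z - r : ℝ) : ℂ) • neumann S z a) (𝓝[>] r) (𝓝 b)) : b ∈ K := by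
  have hcl : IsClosed (K : Set E) := K.closed_of_finiteDimensional
  refine hcl.mem_of_tendsto h (Eventually.of_forall fun z => K.smul_mem _ ?_)
  exact tsum_mem hcl fun j => K.smul_mem _ (hK j)

end Resolvent

/-! ### Positive eigenvectors of a positive map. -/

namespace FiniteCStar

variable {A : Type*} [CStarAlgebra A] [FiniteDimensional ℂ A] [PartialOrder A] [StarOrderedRing A]

/-- The positive eigenvectors of `S` with eigenvalue `r`. -/
def eigenCone (S : A →ₗ[ℂ] A) (r : ℝ) : Set A := {y | S y = (r : ℂ) • y ∧ 0 ≤ y}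

/-- Compression by `1 - q` preserves the order and kills `b`, so it kills `a`. -/
theorem mul_eq_of_le {q a b : A} (hq : IsSelfAdjoint q) (ha : 0 ≤ a) (hab : a ≤ b)
    (h : q * b = b) : q * a = a := by
  have hs : star (1 - q) = 1 - q := by rw [star_sub, star_one, hq.star_eq]
  have h1 : (1 - q) * b = 0 := by rw [sub_mul, one_mul, h, sub_self]
  have h2 : (1 - q) * a * star (1 - q) = 0 := by
    refine le_antisymm ?_ (star_right_conjugate_nonneg ha _)
    have := star_right_conjugate_le_conjugate hab (1 - q)
    rwa [h1, zero_mul] at this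
  have h3 := mul_eq_zero_of_mul_mul_star ha h2
  rw [sub_mul, one_mul, sub_eq_zero] at h3
  exact h3.symm

/-- Finitely many elements of the cone span the same subspace as the cone. Their sum dominates each
of them, and being fixed by left multiplication with its support is a linear condition. -/
theorem exists_mem_eigenCone_max (S : A →ₗ[ℂ] A) (r : ℝ) :
    ∃ y₀ ∈ eigenCone S r, ∀ y ∈ eigenCone S r, support y₀ * y = y := by
  classical
  obtain ⟨t, ht, hspan⟩ := (Submodule.fg_span_iff_fg_span_finset_subset (R := ℂ) (eigenCone S r)).1
    (IsNoetherian.noetherian _)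
  have h0 : ∀ y ∈ t, 0 ≤ y := fun y hy => (ht hy).2
  have hy₀ : 0 ≤ ∑ y ∈ t, y := Finset.sum_nonneg h0
  refine ⟨∑ y ∈ t, y, ⟨?_, hy₀⟩, fun y hy => ?_⟩
  · rw [map_sum, Finset.smul_sum]
    exact Finset.sum_congr rfl fun y hy => (ht hy).1
  · have hmem : y ∈ Submodule.span ℂ (t : Set A) := hspan ▸ Submodule.subset_span hy
    refine (Submodule.span_le (p := LinearMap.ker (LinearMap.mulLeft ℂ (support (∑ y ∈ t, y)) -
      LinearMap.id))).2 (fun z hz => ?_) hmem |> fun h => by simpa [sub_eq_zero] using h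
    have := mul_eq_of_le (isStarProjection_support _).isSelfAdjoint (h0 z hz)
      (Finset.single_le_sum h0 hz) (support_mul (.of_nonneg hy₀))
    simpa [sub_eq_zero] using this

variable {S : A →ₗ[ℂ] A} {r : ℝ}

theorem iterate_nonneg (hS : ∀ a, 0 ≤ a → 0 ≤ S a) {a : A} (ha : 0 ≤ a) (j : ℕ) :
    0 ≤ S^[j] a := by
  induction j with
  | zero => exact ha
  | succ j ih => rw [Function.iterate_succ_apply']; exact hS _ ih

theorem iterate_mono (hS : ∀ a, 0 ≤ a → 0 ≤ S a) {a b : A} (h : a ≤ b) (j : ℕ) :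
    S^[j] a ≤ S^[j] b := by
  have := iterate_nonneg hS (sub_nonneg.2 h) j
  rwa [← Module.End.pow_apply, map_sub, Module.End.pow_apply, Module.End.pow_apply,
    sub_nonneg] at this

theorem iterate_of_eigen {y : A} (hy : S y = (r : ℂ) • y) (j : ℕ) :
    S^[j] y = (r ^ j : ℝ) • y := by
  induction j with
  | zero => simp
  | succ j ih =>
    rw [Function.iterate_succ_apply', ih, ← Complex.coe_smul, map_smul, hy, smul_smul, pow_succ,
      ← Complex.coe_smul, Complex.ofReal_mul]

theorem iterate_real_smul (k : ℝ) (a : A) (j : ℕ) : S^[j] (k • a) = k • S^[j] a := by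
  rw [← Complex.coe_smul, ← Module.End.pow_apply, map_smul, Module.End.pow_apply, Complex.coe_smul]

/-- The limit of the resolvents at the support `p` of a maximal positive eigenvector is a positive
eigenvector with support `p`. -/
theorem exists_tendsto_support (hS : ∀ a, 0 ≤ a → 0 ≤ S a) (hr : 0 ≤ r) {y₀ : A}
    (hy₀ : y₀ ∈ eigenCone S r) (hmax : ∀ y ∈ eigenCone S r, support y₀ * y = y) :
    ∃ ζ ∈ eigenCone S r,
      Tendsto (fun z : ℝ => ((z - r : ℝ) : ℂ) • neumann S z (support y₀)) (𝓝[>] r) (𝓝 ζ) ∧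
      IsRangeProjection (support y₀) ζ := by
  obtain ⟨p, hp⟩ : ∃ p, p = support y₀ := ⟨_, rfl⟩
  obtain ⟨k, hk, hkp⟩ := exists_smul_le_support hy₀.2
  obtain ⟨l, hl, hpl⟩ := exists_support_le_smul hy₀.2
  have hsupp := isRangeProjection_support (.of_nonneg hy₀.2)
  rw [← hp] at hkp hpl hmax hsupp ⊢
  have hp0 : 0 ≤ p := hsupp.1.nonneg
  -- From `p ≤ l y₀` follows `S^j p ≤ l r^j y₀`.
  have hmem : p ∈ growthSubmodule S r := by
    refine ⟨l * ‖y₀‖, fun j => ?_⟩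
    have h := CStarAlgebra.norm_le_norm_of_nonneg_of_le (iterate_nonneg hS hp0 j)
      (iterate_mono hS hpl j)
    refine h.trans_eq ?_
    rw [iterate_real_smul, iterate_of_eigen hy₀.1, norm_smul, norm_smul, Real.norm_of_nonneg hl,
      Real.norm_of_nonneg (by positivity)]
    ring
  obtain ⟨ζ, hζ, hSζ⟩ := exists_tendsto_neumann hr hmem
  -- The scaled resolvent fixes `k y₀` and is monotone, so `k y₀ ≤ p` survives in the limit. This
  -- keeps the support of `ζ` from being smaller than `p`.
  have hkz : k • y₀ ≤ ζ := by
    refine ge_of_tendsto hζ (eventually_nhdsWithin_of_forall fun z hz => ?_)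
    have hz0 : 0 < z := hr.trans_lt hz
    have hSk : S (k • y₀) = (r : ℂ) • k • y₀ := by
      rw [← Complex.coe_smul, map_smul, hy₀.1, smul_comm]
    have hkmem : k • y₀ ∈ growthSubmodule S r := by
      refine ⟨‖k • y₀‖, fun j => ?_⟩
      rw [iterate_of_eigen hSk, norm_smul, Real.norm_of_nonneg (by positivity), mul_comm]
    rw [← smul_neumann_of_eigen hr hSk hz, Complex.coe_smul, Complex.coe_smul]
    refine smul_le_smul_of_nonneg_left ?_ (sub_nonneg.2 (le_of_lt hz))
    refine Summable.tsum_le_tsum (fun j => ?_) (summable_neumann hr hkmem hz)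
      (summable_neumann hr hmem hz)
    rw [Complex.coe_smul, Complex.coe_smul]
    exact smul_le_smul_of_nonneg_left (iterate_mono hS hkp j) (by positivity)
  have hky : 0 ≤ k • y₀ := smul_nonneg hk.le hy₀.2
  have hζc : ζ ∈ eigenCone S r := ⟨hSζ, hky.trans hkz⟩
  refine ⟨ζ, hζc, hζ, hsupp.1, hmax ζ hζc, fun q hq hqζ => hsupp.2.2 q hq ?_⟩
  have h := mul_eq_of_le hq.isSelfAdjoint hky hkz hqζ
  rw [mul_smul_comm] at h
  exact (smul_right_injective A hk.ne') h

/-- The point is that `c` commutes with `ζ`, for otherwise `ζ c` need not be positive. As `c y₀ c`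
is again in the cone, `c` maps the range of `p` into itself and, being self-adjoint, commutes with
`p`. The commutant of `c` is invariant under `S` and closed, so it contains the limit. -/
theorem mul_mem_eigenCone {y₀ : A}
    (hy₀ : y₀ ∈ eigenCone S r) (hmax : ∀ y ∈ eigenCone S r, support y₀ * y = y) {ζ : A}
    (hζ : ζ ∈ eigenCone S r)
    (hlim : Tendsto (fun z : ℝ => ((z - r : ℝ) : ℂ) • neumann S z (support y₀)) (𝓝[>] r) (𝓝 ζ))
    {c : A} (hc : 0 ≤ c) (hl : ∀ a, S (c * a) = c * S a) (hr : ∀ a, S (a * c) = S a * c) :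
    ζ * c ∈ eigenCone S r := by
  have hca : star c = c := (IsSelfAdjoint.of_nonneg hc).star_eq
  have hsupp := isRangeProjection_support (.of_nonneg hy₀.2)
  obtain ⟨p, hp⟩ : ∃ p, p = support y₀ := ⟨_, rfl⟩
  rw [← hp] at hmax hlim hsupp
  have hps : star p = p := hsupp.1.isSelfAdjoint.star_eq
  have h1 : c * y₀ * c ∈ eigenCone S r := by
    refine ⟨by rw [hr, hl, hy₀.1, mul_smul_comm, smul_mul_assoc], ?_⟩
    have := star_right_conjugate_nonneg hy₀.2 c
    rwa [hca] at this
  have h2 : (1 - p) * c * y₀ * star ((1 - p) * c) = 0 := by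
    rw [star_mul, hca, ← mul_assoc, mul_assoc (1 - p) c y₀, mul_assoc (1 - p), sub_mul, one_mul,
      hmax _ h1, sub_self, zero_mul]
  have h3 := mul_eq_zero_of_mul_mul_star hy₀.2 h2
  obtain ⟨g, hg⟩ := hsupp.exists_eq_mul (.of_nonneg hy₀.2)
  have h4 : c * p = p * c * p := by
    have : (1 - p) * c * p = 0 := by
      conv_lhs => enter [2]; rw [hg]
      rw [← mul_assoc, h3, zero_mul]
    rw [sub_mul, one_mul, sub_mul, sub_eq_zero] at this
    exact this
  have h5 : p * c = c * p := by
    have := congrArg star h4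
    simp only [star_mul, hca, hps] at this
    rw [this, ← mul_assoc, ← h4]
  let K : Submodule ℂ A := LinearMap.ker (LinearMap.mulLeft ℂ c - LinearMap.mulRight ℂ c)
  have hK : ∀ a, a ∈ K ↔ c * a = a * c := fun a => by
    simp [K, sub_eq_zero]
  have hit : ∀ j : ℕ, S^[j] p ∈ K := by
    intro j
    induction j with
    | zero => rw [hK]; exact h5.symm
    | succ j ih =>
      rw [hK] at ih ⊢
      rw [Function.iterate_succ_apply', ← hl, ih, hr]
  have hcζ : Commute ζ c := ((hK ζ).1 (mem_of_tendsto_neumann K hit hlim)).symm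
  exact ⟨by rw [hr, hζ.1, smul_mul_assoc], hcζ.mul_nonneg hζ.2 hc⟩

end FiniteCStar

/-! ### A calculus of layers for planar isotopy. -/

namespace PlanarStarAlgebra

variable {P : PlanarStarAlgebra.{u}}

theorem castHom_heq {ε : Shading} {a a' b b' : ℕ} (ha : a = a') (hb : b = b') (f : P.Hom ε a b) :
    HEq (P.castHom ha hb f) f := by
  subst ha hb; rfl

theorem tensor_heq {ε η η' : Shading} {a a' b b' c c' d d' : ℕ} {h : shade ε a = η}
    {h' : shade ε a' = η'} {f : P.Hom ε a b} {f' : P.Hom ε a' b'} {g : P.Hom η c d}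
    {g' : P.Hom η' c' d'} (ha : a = a') (hb : b = b') (hc : c = c') (hd : d = d')
    (hf : HEq f f') (hg : HEq g g') : HEq (P.tensor h f g) (P.tensor h' f' g') := by
  subst ha hb hc hd h h'
  rw [eq_of_heq hf, eq_of_heq hg]

theorem shade_add (ε : Shading) (a b : ℕ) : shade ε (a + b) = shade (shade ε a) b := by
  simp [shade, Nat.bodd_add]

theorem shade_four (ε : Shading) : shade ε 4 = ε := by cases ε <;> rfl

theorem shade_three_of {ε η : Shading} (h : η = !ε) : shade ε 3 = η := by
  subst h; cases ε <;> rfl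

/-- The picture with `i` straight strings on the left of `f` and `j` straight strings on its
right. -/
def layer (ε θ : Shading) {ζ : Shading} {a b : ℕ} (i j m n : ℕ) (f : P.Hom ζ a b)
    (h : shade ε i = ζ := by
      first
        | with_reducible exact shade_zero _
        | with_reducible exact shade_two _
        | with_reducible exact shade_four _
        | with_reducible exact shade_one_of (by assumption)
        | with_reducible exact shade_one_of' (by assumption)
        | with_reducible exact shade_three_of (by assumption)
        | with_reducible exact shade_three_of' (by assumption))
    (h' : shade ζ a = θ := by
      first
        | with_reducible exact shade_zero _
        | with_reducible exact shade_two _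
        | with_reducible exact shade_four _
        | with_reducible exact shade_one_of (by assumption)
        | with_reducible exact shade_one_of' (by assumption)
        | with_reducible exact shade_three_of (by assumption)
        | with_reducible exact shade_three_of' (by assumption))
    (hm : i + (a + j) = m := by rfl) (hn : i + (b + j) = n := by rfl) : P.Hom ε m n :=
  P.castHom hm hn (P.tensor h (P.ident ε i) (P.tensor h' f (P.ident θ j)))

section layer

variable {ε ζ θ : Shading} {a b m n i j : ℕ}

theorem layer_heq {h : shade ε i = ζ} {h' : shade ζ a = θ}
    {hm : i + (a + j) = m} {hn : i + (b + j) = n} (f : P.Hom ζ a b) :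
    HEq (layer _ _ i j _ _ f h h' hm hn) (P.tensor h (P.ident ε i) (P.tensor h' f (P.ident θ j))) :=
  castHom_heq _ _ _

theorem ident_zero_tensor {η : Shading} (h : shade ε 0 = η) (f : P.Hom η a b) :
    HEq (P.tensor h (P.ident ε 0) f) f := by
  obtain rfl : ε = η := by rw [← h, shade_zero]
  exact P.empty_tensor f

theorem layer_zero_zero (h : shade ε 0 = ε) (h' : shade ε a = θ)
    (hm : 0 + (a + 0) = a) (hn : 0 + (b + 0) = b) (f : P.Hom ε a b) :
    layer _ _ 0 0 _ _ f h h' hm hn = f := by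
  apply eq_of_heq
  refine (layer_heq f).trans ((ident_zero_tensor _ _).trans ?_)
  rw [P.tensor_empty]

theorem layer_ident {h : shade ε i = ζ} {h' : shade ζ a = θ}
    {hm : i + (a + j) = m} {hn : i + (a + j) = m} :
    layer _ _ i j _ _ (P.ident ζ a) h h' hm hn = P.ident ε m := by
  subst hm
  apply eq_of_heq
  refine (layer_heq _).trans ?_
  rw [P.ident_tensor_ident, P.ident_tensor_ident]

theorem layer_comp {c k : ℕ} {h : shade ε i = ζ} {h' : shade ζ a = θ} {hm : i + (a + j) = m}
    {hk : i + (c + j) = k} (h'' : shade ζ b = θ) (hn : i + (b + j) = n) (f : P.Hom ζ a b)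
    (g : P.Hom ζ b c) :
    layer _ _ i j _ _ (P.comp f g) h h' hm hk =
      P.comp (layer _ _ i j _ _ f h h' hm hn) (layer _ _ i j _ _ g h h'' hn hk) := by
  subst hm hn hk
  simp only [layer, PlanarData.castHom]
  rw [← P.tensor_comp, ← P.tensor_comp, P.ident_comp, P.ident_comp]

/-- Puts a framed composite into normal form one factor at a time. The factors are rewritten for
arbitrary proofs of the shading and arithmetic conditions, so that `rfl` and `layer_layer` apply
directly. -/
theorem layer_comp_eq {c k : ℕ} {h : shade ε i = ζ} {h' : shade ζ a = θ} {hm : i + (a + j) = m}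
    {hk : i + (c + j) = k} {f : P.Hom ζ a b} {g : P.Hom ζ b c} {F : P.Hom ε m n} {G : P.Hom ε n k}
    (hF : ∀ hn, layer _ _ i j _ _ f h h' hm hn = F)
    (hG : ∀ (h'' : shade ζ b = θ) hn, layer _ _ i j _ _ g h h'' hn hk = G)
    (h'' : shade ζ b = θ := by
      first
        | with_reducible exact shade_zero _
        | with_reducible exact shade_two _
        | with_reducible exact shade_four _
        | with_reducible exact shade_one_of (by assumption)
        | with_reducible exact shade_one_of' (by assumption)
        | with_reducible exact shade_three_of (by assumption)
        | with_reducible exact shade_three_of' (by assumption))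
    (hn : i + (b + j) = n := by rfl) :
    layer _ _ i j _ _ (P.comp f g) h h' hm hk = P.comp F G := by
  rw [layer_comp h'' hn, hF, hG]

theorem layer_layer {ε' θ' : Shading} {m' n' i' j' i'' j'' : ℕ}
    {h : shade ε i = ζ} {h' : shade ζ m = θ} {hm' : i + (m + j) = m'} {hn' : i + (n + j) = n'}
    {k : shade ζ i' = ε'} {k' : shade ε' a = θ'} {hm : i' + (a + j') = m} {hn : i' + (b + j') = n}
    (hi : i + i' = i'') (hj : j' + j = j'') (f : P.Hom ε' a b) :
    layer _ _ i j _ _ (layer _ _ i' j' _ _ f k k' hm hn) h h' hm' hn' =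
      layer _ _ i'' j'' _ _ f (by rw [← hi, shade_add, h, k]) k' (by omega) (by omega) := by
  subst hi hj hm hn hm' hn'
  have hθ : shade θ' j' = θ := by rw [← h', shade_add, k, shade_add, k']
  apply eq_of_heq
  refine (layer_heq _).trans (HEq.trans ?_ (layer_heq _).symm)
  have e1 : HEq (P.tensor h' (layer _ _ i' j' _ _ f k k' rfl rfl) (P.ident θ j))
      (P.tensor k (P.ident ζ i') (P.tensor k' f (P.ident θ' (j' + j)))) := by
    refine (P.tensor_assoc k (show shade ε' (a + j') = θ by rw [shade_add, k', hθ]) h'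
      (P.ident ζ i') (P.tensor k' f (P.ident θ' j')) (P.ident θ j)).trans ?_
    · refine tensor_heq rfl rfl (by omega) (by omega) HEq.rfl ?_
      refine (P.tensor_assoc k' hθ _ _ _ _).trans ?_
      rw [P.ident_tensor_ident]
  refine (tensor_heq (h' := h) rfl rfl (by omega) (by omega) HEq.rfl e1).trans ?_
  refine (P.tensor_assoc h k (by rw [shade_add, h, k]) _ _ _).symm.trans ?_
  rw [P.ident_tensor_ident]

theorem tensor_ident_eq_layer {h : shade ε a = θ} (f : P.Hom ε a b)
    (h' : shade ε 0 = ε := by exact shade_zero _) (hm : 0 + (a + j) = a + j := by omega)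
    (hn : 0 + (b + j) = b + j := by omega) :
    P.tensor h f (P.ident θ j) = layer _ _ 0 j _ _ f h' h hm hn :=
  eq_of_heq ((layer_heq f).trans (ident_zero_tensor _ _)).symm

theorem ident_tensor_eq_layer (h : shade ε i = ζ) {h' : shade ζ a = θ} (f : P.Hom ζ a b) :
    P.tensor h (P.ident ε i) f = layer _ _ i 0 _ _ f h h' rfl rfl := by
  apply eq_of_heq
  refine HEq.trans ?_ (layer_heq f).symm
  rw [P.tensor_empty]

theorem tensor_eq_comp {c d : ℕ} (h : shade ε a = ζ) (h' : shade ε b = ζ) (f : P.Hom ε a b)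
    (g : P.Hom ζ c d) :
    P.tensor h f g = P.comp (P.tensor h f (P.ident ζ c)) (P.tensor h' (P.ident ε b) g) := by
  rw [← P.tensor_comp, P.comp_ident, P.ident_comp]

/-- Pictures in disjoint parts of a row can be moved past each other vertically. -/
theorem layer_comm {ζ' θ' : Shading} {c d m₁ m₂ m₃ m₄ i₁ i₂ j₁ j₂ : ℕ} (k : ℕ)
    {h : shade ε i = ζ} {h' : shade ζ a = θ}
    {k₁ : shade ε i₁ = ζ'} {k₂ : shade ε i₂ = ζ'} {k' : shade ζ' c = θ'}
    {e₁ : i + (a + j₁) = m₁} {e₂ : i + (b + j₁) = m₂} {e₃ : i₁ + (c + j) = m₂}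
    {e₄ : i₁ + (d + j) = m₄} {e₅ : i₂ + (c + j) = m₁} {e₆ : i₂ + (d + j) = m₃}
    {e₇ : i + (a + j₂) = m₃} {e₈ : i + (b + j₂) = m₄} {f : P.Hom ζ a b} {g : P.Hom ζ' c d}
    (h'' : shade ζ b = θ := by
      first
        | with_reducible exact shade_zero _
        | with_reducible exact shade_two _
        | with_reducible exact shade_four _
        | with_reducible exact shade_one_of (by assumption)
        | with_reducible exact shade_one_of' (by assumption)
        | with_reducible exact shade_three_of (by assumption)
        | with_reducible exact shade_three_of' (by assumption))
    (hi₁ : i₁ = i + b + k := by rfl) (hi₂ : i₂ = i + a + k := by rfl) :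
    P.comp (layer _ _ i j₁ _ _ f h h' e₁ e₂) (layer _ _ i₁ j _ _ g k₁ k' e₃ e₄) =
      P.comp (layer _ _ i₂ j _ _ g k₂ k' e₅ e₆) (layer _ _ i j₂ _ _ f h h' e₇ e₈) := by
  obtain rfl : j₁ = k + (c + j) := by omega
  obtain rfl : j₂ = k + (d + j) := by omega
  subst hi₁ hi₂ e₁ e₂ e₇ e₈
  have hθ : shade θ k = ζ' := by rw [← k₁, shade_add, shade_add, h, h'']
  -- Everything to the right of `f` is gathered in one picture `G`, so that the claim becomes the
  -- interchange law for `f` and `G`.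
  obtain ⟨G, hG⟩ : ∃ G, G = layer _ _ k j _ _ g hθ k' rfl rfl := ⟨_, rfl⟩
  have hG' : shade θ (k + (c + j)) = shade θ' j := by rw [shade_add, hθ, shade_add, k']
  have l1 : layer _ _ (i + b + k) j _ _ g k₁ k' e₃ e₄ =
      P.tensor h (P.ident ε i) (P.tensor h'' (P.ident ζ b) G) := by
    rw [hG, ident_tensor_eq_layer h'' (h' := hG'), ident_tensor_eq_layer h (θ := shade θ' j)
      (h' := by rw [shade_add, h'', hG']), layer_layer rfl rfl]
    exact (layer_layer (by omega) (by omega) _).symm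
  have l2 : layer _ _ (i + a + k) j _ _ g k₂ k' e₅ e₆ =
      P.tensor h (P.ident ε i) (P.tensor h' (P.ident ζ a) G) := by
    rw [hG, ident_tensor_eq_layer h' (h' := hG'), ident_tensor_eq_layer h (θ := shade θ' j)
      (h' := by rw [shade_add, h', hG']), layer_layer rfl rfl]
    exact (layer_layer (by omega) (by omega) _).symm
  rw [l1, l2]
  simp only [layer, PlanarData.castHom]
  rw [← P.tensor_comp, ← P.tensor_comp, ← P.tensor_comp, ← P.tensor_comp]
  simp only [P.ident_comp, P.comp_ident]

end layer

theorem layer_add {ε ζ θ : Shading} {a b m n i j : ℕ} {h : shade ε i = ζ} {h' : shade ζ a = θ}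
    {hm : i + (a + j) = m} {hn : i + (b + j) = n} (f g : P.Hom ζ a b) :
    layer _ _ i j _ _ (f + g) h h' hm hn =
      layer _ _ i j _ _ f h h' hm hn + layer _ _ i j _ _ g h h' hm hn := by
  subst hm hn
  simp only [layer, PlanarData.castHom, map_add, LinearMap.add_apply]

theorem layer_smul {ε ζ θ : Shading} {a b m n i j : ℕ} {h : shade ε i = ζ} {h' : shade ζ a = θ}
    {hm : i + (a + j) = m} {hn : i + (b + j) = n} (c : ℂ) (f : P.Hom ζ a b) :
    layer _ _ i j _ _ (c • f) h h' hm hn = c • layer _ _ i j _ _ f h h' hm hn := by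
  subst hm hn
  simp only [layer, PlanarData.castHom, map_smul, LinearMap.smul_apply]

theorem layer_zero {ε ζ θ : Shading} {a b m n i j : ℕ} {h : shade ε i = ζ} {h' : shade ζ a = θ}
    {hm : i + (a + j) = m} {hn : i + (b + j) = n} :
    layer _ _ i j _ _ (0 : P.Hom ζ a b) h h' hm hn = 0 := by
  simpa using layer_smul (h := h) (h' := h') (hm := hm) (hn := hn) 0 (0 : P.Hom ζ a b)

theorem dagger_ident {ε : Shading} {a : ℕ} : P.dagger (P.ident ε a) = P.ident ε a := by
  have h := P.ident_comp (P.dagger (P.ident ε a))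
  have h' := congrArg P.dagger h
  rw [P.dagger_comp, P.dagger_dagger, P.ident_comp] at h'
  exact h'

theorem dagger_layer {ε ζ θ : Shading} {a b m n i j : ℕ} {h : shade ε i = ζ} {h' : shade ζ a = θ}
    {hm : i + (a + j) = m} {hn : i + (b + j) = n} (f : P.Hom ζ a b)
    (h'' : shade ζ b = θ := by
      first
        | with_reducible exact shade_zero _
        | with_reducible exact shade_two _
        | with_reducible exact shade_four _
        | with_reducible exact shade_one_of (by assumption)
        | with_reducible exact shade_one_of' (by assumption)
        | with_reducible exact shade_three_of (by assumption)
        | with_reducible exact shade_three_of' (by assumption)) :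
    P.dagger (layer _ _ i j _ _ f h h' hm hn) = layer _ _ i j _ _ (P.dagger f) h h'' hn hm := by
  subst hm hn
  simp only [layer, PlanarData.castHom]
  rw [P.dagger_tensor h h, P.dagger_tensor h' h'', dagger_ident, dagger_ident]

theorem dagger_cap (ε : Shading) : P.dagger (P.cap ε) = P.cup ε := by
  rw [← P.dagger_cup, P.dagger_dagger]

theorem comp_comp_congr {ε : Shading} {a b b' c d : ℕ} {f : P.Hom ε a b} {g : P.Hom ε b c}
    {f' : P.Hom ε a b'} {g' : P.Hom ε b' c} (e : P.comp f g = P.comp f' g') (k : P.Hom ε c d) :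
    P.comp f (P.comp g k) = P.comp f' (P.comp g' k) := by
  rw [← P.comp_assoc, e, P.comp_assoc]

theorem comp_comp_cancel {ε : Shading} {a b d : ℕ} {f : P.Hom ε a b} {g : P.Hom ε b a}
    (e : P.comp f g = P.ident ε a) (k : P.Hom ε a d) : P.comp f (P.comp g k) = k := by
  rw [← P.comp_assoc, e, P.ident_comp]

variable {ε η : Shading}

theorem zigzag_layer (h : η = !ε) :
    P.comp (layer ε η 1 0 1 3 (P.cup η)) (layer ε ε 0 1 3 1 (P.cap ε)) = P.ident ε 1 := by
  subst h
  rw [← P.zigzag ε, ident_tensor_eq_layer, tensor_ident_eq_layer]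

theorem zigzag_layer' (h : η = !ε) :
    P.comp (layer ε ε 0 1 1 3 (P.cup ε)) (layer ε η 1 0 3 1 (P.cap η)) = P.ident ε 1 := by
  subst h
  rw [← P.zigzag' ε, tensor_ident_eq_layer (P.cup ε), ident_tensor_eq_layer _ (P.cap (!ε))]

end PlanarStarAlgebra

/-! ### Isotopies for the Fourier transform, convolution and exchange relations. -/

namespace CStarPlanarAlgebra
open PlanarStarAlgebra

variable {P : CStarPlanarAlgebra.{u}} {ε η : Shading}

theorem conj_eq (h : η = !ε) (y : P.Hom ε 1 1) :
    (conj (P := P) h y : P.Hom η 1 1) = P.comp (layer η ε 1 0 1 3 (P.cup ε))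
      (P.comp (layer η η 1 1 3 3 y) (layer η η 0 1 3 1 (P.cap η))) := by
  have e1 := ident_tensor_eq_layer (P := P.toPlanarStarAlgebra) (i := 1) (shade_one_of' h)
    (h' := shade_zero ε) (P.cup ε)
  have e2 := ident_tensor_eq_layer (P := P.toPlanarStarAlgebra) (i := 1) (shade_one_of' h)
    (h' := shade_one_of h) y
  have e3 := tensor_ident_eq_layer (P := P.toPlanarStarAlgebra) (j := 1) (h := shade_two η) (P.cap η)
  have e4 : P.tensor (a := 2) (b := 2) (shade_two η)
      (P.tensor (b := 1) (d := 1) (shade_one_of' h) (P.ident η 1) y) (P.ident η 1) =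
      layer η η 1 1 3 3 y := by
    rw [e2]
    refine (tensor_ident_eq_layer (P := P.toPlanarStarAlgebra) (j := 1)
      (a := 2) (b := 2) (h := shade_two η) _).trans ?_
    exact layer_layer rfl rfl y
  rw [← e4]
  unfold conj
  rw [e1, e3]

theorem fourier_eq (h : η = !ε) (x : P.Hom ε 2 2) :
    (fourier (P := P) h x : P.Hom η 2 2) = P.comp (layer η η 0 2 2 4 (P.cup η))
      (P.comp (layer η ε 1 1 4 4 x) (layer η η 2 0 4 2 (P.cap η))) := by
  have e1 := tensor_ident_eq_layer (P := P.toPlanarStarAlgebra) (b := 2) (j := 2) (h := shade_zero η) (P.cup η)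
  have e2 := ident_tensor_eq_layer (P := P.toPlanarStarAlgebra) (i := 1) (shade_one_of' h)
    (h' := shade_two ε) x
  have e3 := ident_tensor_eq_layer (P := P.toPlanarStarAlgebra) (i := 2) (shade_two η)
    (h' := shade_two η) (P.cap η)
  have e4 : P.tensor (a := 3) (b := 3) (shade_three_of' h)
      (P.tensor (b := 1) (d := 2) (shade_one_of' h) (P.ident η 1) x) (P.ident ε 1) =
      layer η ε 1 1 4 4 x := by
    rw [e2]
    refine (tensor_ident_eq_layer (P := P.toPlanarStarAlgebra) (j := 1)
      (a := 3) (b := 3) (h := shade_three_of' h) _).trans ?_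
    exact layer_layer rfl rfl x
  rw [← e4]
  unfold fourier
  rw [e1, e3]

theorem convLeft_eq (h : η = !ε) (y : P.Hom ε 1 1) (a : P.Hom η 2 2) :
    (convLeft (P := P) h y a : P.Hom ε 1 1) = P.comp (layer ε ε 0 1 1 3 (P.cup ε))
      (P.comp (layer ε η 0 2 3 3 y) (P.comp (layer ε η 1 0 3 3 a)
        (layer ε ε 0 1 3 1 (P.cap ε)))) := by
  have e1 := tensor_ident_eq_layer (P := P.toPlanarStarAlgebra) (b := 2) (j := 1) (h := shade_zero ε) (P.cup ε)
  have e2 : P.tensor (b := 1) (d := 2) (shade_one_of h) y a =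
      P.comp (layer ε η 0 2 3 3 y) (layer ε η 1 0 3 3 a) := by
    rw [tensor_eq_comp (shade_one_of h) (shade_one_of h),
      ident_tensor_eq_layer (h' := shade_two η), tensor_ident_eq_layer]
  have e3 := tensor_ident_eq_layer (P := P.toPlanarStarAlgebra) (j := 1) (h := shade_two ε) (P.cap ε)
  rw [← P.comp_assoc (layer ε η 0 2 3 3 y), ← e2]
  unfold convLeft
  rw [e1, e3]

theorem convRight_eq (h : η = !ε) (a : P.Hom η 2 2) (z : P.Hom η 1 1) :
    (convRight (P := P) h a z : P.Hom η 1 1) = P.comp (layer η ε 1 0 1 3 (P.cup ε))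
      (P.comp (layer η η 0 1 3 3 a) (P.comp (layer η ε 2 0 3 3 z)
        (layer η ε 1 0 3 1 (P.cap ε)))) := by
  have e1 := ident_tensor_eq_layer (P := P.toPlanarStarAlgebra) (i := 1) (shade_one_of' h)
    (h' := shade_zero ε) (P.cup ε)
  have e2 : P.tensor (b := 2) (d := 1) (shade_two η) a z =
      P.comp (layer η η 0 1 3 3 a) (layer η ε 2 0 3 3 z) := by
    rw [tensor_eq_comp (shade_two η) (shade_two η), ident_tensor_eq_layer]
    rw [tensor_ident_eq_layer]
  have e3 := ident_tensor_eq_layer (P := P.toPlanarStarAlgebra) (i := 1) (shade_one_of' h)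
    (h' := shade_two ε) (P.cap ε)
  rw [← P.comp_assoc (layer η η 0 1 3 3 a), ← e2]
  unfold convRight
  rw [e1, e3]

theorem onLeft_eq (h : η = !ε) (y : P.Hom ε 1 1) :
    (onLeft (P := P) h y : P.Hom ε 2 2) = layer ε η 0 1 2 2 y := by
  unfold onLeft
  rw [tensor_ident_eq_layer]

theorem onRight_eq (h : η = !ε) (z : P.Hom η 1 1) :
    (onRight (P := P) h z : P.Hom ε 2 2) = layer ε ε 1 0 2 2 z := by
  unfold onRight
  rw [ident_tensor_eq_layer]

/-- Sliding a box through a cup. -/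
theorem cup_slide (h : η = !ε) (c : P.Hom ε 1 1) :
    P.comp (P.cup ε) (layer ε η 0 1 2 2 c) =
      P.comp (P.cup ε) (layer ε ε 1 0 2 2 (conj (P := P) h c)) := by
  have e0 : layer ε ε 1 0 2 2 (conj (P := P) h c) = P.comp (layer ε ε 2 0 2 4 (P.cup ε))
      (P.comp (layer ε η 2 1 4 4 c) (layer ε η 1 1 4 2 (P.cap η))) := by
    rw [conj_eq]
    exact layer_comp_eq (fun _ => layer_layer rfl rfl _) fun _ _ =>
      layer_comp_eq (fun _ => layer_layer rfl rfl _) fun _ _ => layer_layer rfl rfl _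
  have e1 : P.comp (layer ε ε 0 0 0 2 (P.cup ε)) (layer ε ε 2 0 2 4 (P.cup ε)) =
      P.comp (layer ε ε 0 0 0 2 (P.cup ε)) (layer ε ε 0 2 2 4 (P.cup ε)) := layer_comm 0
  have e2 : P.comp (layer ε ε 0 2 2 4 (P.cup ε)) (layer ε η 2 1 4 4 c) =
      P.comp (layer ε η 0 1 2 2 c) (layer ε ε 0 2 2 4 (P.cup ε)) := layer_comm 0
  have e3 : P.comp (layer ε ε 0 2 2 4 (P.cup ε)) (layer ε η 1 1 4 2 (P.cap η)) = P.ident ε 2 := by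
    have : layer ε η 0 1 2 2 (P.comp (layer ε ε 0 1 1 3 (P.cup ε)) (layer ε η 1 0 3 1 (P.cap η))) =
        P.comp (layer ε ε 0 2 2 4 (P.cup ε)) (layer ε η 1 1 4 2 (P.cap η)) :=
      layer_comp_eq (fun _ => layer_layer rfl rfl _) fun _ _ => layer_layer rfl rfl _
    rw [← this, zigzag_layer' h, layer_ident]
  rw [layer_zero_zero] at e1
  rw [e0, comp_comp_congr e1, comp_comp_congr e2, e3, P.comp_ident]

/-- Sliding a box through a cap. -/
theorem cap_slide (h : η = !ε) (c : P.Hom ε 1 1) :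
    P.comp (layer η η 1 0 2 2 c) (P.cap η) =
      P.comp (layer η ε 0 1 2 2 (conj (P := P) h c)) (P.cap η) := by
  have e0 : layer η ε 0 1 2 2 (conj (P := P) h c) = P.comp (layer η ε 1 1 2 4 (P.cup ε))
      (P.comp (layer η η 1 2 4 4 c) (layer η η 0 2 4 2 (P.cap η))) := by
    rw [conj_eq]
    exact layer_comp_eq (fun _ => layer_layer rfl rfl _) fun _ _ =>
      layer_comp_eq (fun _ => layer_layer rfl rfl _) fun _ _ => layer_layer rfl rfl _
  have e1 : P.comp (layer η η 0 2 4 2 (P.cap η)) (layer η η 0 0 2 0 (P.cap η)) =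
      P.comp (layer η η 2 0 4 2 (P.cap η)) (layer η η 0 0 2 0 (P.cap η)) := layer_comm 0
  have e2 : P.comp (layer η η 1 2 4 4 c) (layer η η 2 0 4 2 (P.cap η)) =
      P.comp (layer η η 2 0 4 2 (P.cap η)) (layer η η 1 0 2 2 c) := layer_comm 0
  have e3 : P.comp (layer η ε 1 1 2 4 (P.cup ε)) (layer η η 2 0 4 2 (P.cap η)) = P.ident η 2 := by
    have : layer η η 1 0 2 2 (P.comp (layer ε ε 0 1 1 3 (P.cup ε)) (layer ε η 1 0 3 1 (P.cap η))) =
        P.comp (layer η ε 1 1 2 4 (P.cup ε)) (layer η η 2 0 4 2 (P.cap η)) :=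
      layer_comp_eq (fun _ => layer_layer rfl rfl _) fun _ _ => layer_layer rfl rfl _
    rw [← this, zigzag_layer' h, layer_ident]
  rw [layer_zero_zero] at e1
  rw [e0, P.comp_assoc, P.comp_assoc, e1, comp_comp_congr e2, ← P.comp_assoc, e3, P.ident_comp]

/-- The picture `x` with its upper right string bent down. -/
def bend (η : Shading) (h : η = !ε) (x : P.Hom ε 2 2) : P.Hom ε 3 1 :=
  P.comp (layer ε ε 0 1 3 3 x) (layer ε η 1 0 3 1 (P.cap η))

/-- Capping the left string of `x̂` undoes one of its two bends, so that `y ∗ x̂` can be expressed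
through `x` itself. -/
theorem fourier_cap (h : η = !ε) (x : P.Hom ε 2 2) :
    P.comp (layer ε η 1 0 3 3 (fourier (P := P) h x)) (layer ε ε 0 1 3 1 (P.cap ε)) =
      bend η h x := by
  have e0 : layer ε η 1 0 3 3 (fourier (P := P) h x) = P.comp (layer ε η 1 2 3 5 (P.cup η))
      (P.comp (layer ε ε 2 1 5 5 x) (layer ε η 3 0 5 3 (P.cap η))) := by
    rw [fourier_eq]
    exact layer_comp_eq (fun _ => layer_layer rfl rfl _) fun _ _ =>
      layer_comp_eq (fun _ => layer_layer rfl rfl _) fun _ _ => layer_layer rfl rfl _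
  have e1 : P.comp (layer ε η 3 0 5 3 (P.cap η)) (layer ε ε 0 1 3 1 (P.cap ε)) =
      P.comp (layer ε ε 0 3 5 3 (P.cap ε)) (layer ε η 1 0 3 1 (P.cap η)) := (layer_comm 1).symm
  have e2 : P.comp (layer ε ε 2 1 5 5 x) (layer ε ε 0 3 5 3 (P.cap ε)) =
      P.comp (layer ε ε 0 3 5 3 (P.cap ε)) (layer ε ε 0 1 3 3 x) := (layer_comm 0).symm
  have e3 : P.comp (layer ε η 1 2 3 5 (P.cup η)) (layer ε ε 0 3 5 3 (P.cap ε)) = P.ident ε 3 := by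
    have : layer ε η 0 2 3 3 (P.comp (layer ε η 1 0 1 3 (P.cup η)) (layer ε ε 0 1 3 1 (P.cap ε))) =
        P.comp (layer ε η 1 2 3 5 (P.cup η)) (layer ε ε 0 3 5 3 (P.cap ε)) :=
      layer_comp_eq (fun _ => layer_layer rfl rfl _) fun _ _ => layer_layer rfl rfl _
    rw [← this, zigzag_layer h, layer_ident]
  rw [e0, P.comp_assoc, P.comp_assoc, e1, comp_comp_congr e2, comp_comp_cancel e3, bend]

theorem convLeft_fourier (h : η = !ε) (y : P.Hom ε 1 1) (x : P.Hom ε 2 2) :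
    (convLeft (P := P) h y (fourier (P := P) h x) : P.Hom ε 1 1) =
      P.comp (layer ε ε 0 1 1 3 (P.cup ε)) (P.comp (layer ε η 0 2 3 3 y) (bend η h x)) := by
  refine (convLeft_eq h y _).trans ?_
  rw [fourier_cap]

theorem eq_cup_bend (h : η = !ε) (x : P.Hom ε 2 2) :
    P.comp (layer ε ε 2 0 2 4 (P.cup ε)) (layer ε η 0 1 4 2 (bend η h x)) = x := by
  have e0 : layer ε η 0 1 4 2 (bend η h x) =
      P.comp (layer ε ε 0 2 4 4 x) (layer ε η 1 1 4 2 (P.cap η)) :=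
    layer_comp_eq (fun _ => layer_layer rfl rfl _) fun _ _ => layer_layer rfl rfl _
  have e1 : P.comp (layer ε ε 2 0 2 4 (P.cup ε)) (layer ε ε 0 2 4 4 x) =
      P.comp (layer ε ε 0 0 2 2 x) (layer ε ε 2 0 2 4 (P.cup ε)) := (layer_comm 0).symm
  have e2 : P.comp (layer ε ε 2 0 2 4 (P.cup ε)) (layer ε η 1 1 4 2 (P.cap η)) = P.ident ε 2 := by
    have : layer ε ε 1 0 2 2 (P.comp (layer η ε 1 0 1 3 (P.cup ε)) (layer η η 0 1 3 1 (P.cap η))) =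
        P.comp (layer ε ε 2 0 2 4 (P.cup ε)) (layer ε η 1 1 4 2 (P.cap η)) :=
      layer_comp_eq (fun _ => layer_layer rfl rfl _) fun _ _ => layer_layer rfl rfl _
    rw [← this, zigzag_layer (opp_symm h), layer_ident]
  rw [layer_zero_zero] at e1
  rw [e0, comp_comp_congr e1, e2, P.comp_ident]

theorem eq_cup_fourier_cap (h : η = !ε) (x : P.Hom ε 2 2) :
    P.comp (layer ε ε 2 0 2 4 (P.cup ε)) (P.comp
      (layer ε η 1 1 4 4 (fourier (P := P) h x)) (layer ε ε 0 2 4 2 (P.cap ε))) = x := by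
  have e0 : layer ε η 0 1 4 2 (bend η h x) = P.comp
      (layer ε η 1 1 4 4 (fourier (P := P) h x)) (layer ε ε 0 2 4 2 (P.cap ε)) := by
    rw [← fourier_cap]
    exact layer_comp_eq (fun _ => layer_layer rfl rfl _) fun _ _ => layer_layer rfl rfl _
  rw [← e0, eq_cup_bend]

/-- Straightening the bent lower left string recovers `k`. -/
theorem cup_comp_injective (h : η = !ε) {k k' : P.Hom η 2 2}
    (hk : P.comp (layer ε ε 0 1 1 3 (P.cup ε)) (layer ε η 1 0 3 3 k) =
      P.comp (layer ε ε 0 1 1 3 (P.cup ε)) (layer ε η 1 0 3 3 k')) : k = k' := by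
  have key : ∀ l : P.Hom η 2 2, P.comp (layer η η 1 0 2 4 (P.comp (layer ε ε 0 1 1 3 (P.cup ε))
      (layer ε η 1 0 3 3 l))) (layer η η 0 2 4 2 (P.cap η)) = l := by
    intro l
    have e0 : layer η η 1 0 2 4 (P.comp (layer ε ε 0 1 1 3 (P.cup ε)) (layer ε η 1 0 3 3 l)) =
        P.comp (layer η ε 1 1 2 4 (P.cup ε)) (layer η η 2 0 4 4 l) :=
      layer_comp_eq (fun _ => layer_layer rfl rfl _) fun _ _ => layer_layer rfl rfl _
    have e1 : P.comp (layer η η 2 0 4 4 l) (layer η η 0 2 4 2 (P.cap η)) =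
        P.comp (layer η η 0 2 4 2 (P.cap η)) (layer η η 0 0 2 2 l) := (layer_comm 0).symm
    have e2 : P.comp (layer η ε 1 1 2 4 (P.cup ε)) (layer η η 0 2 4 2 (P.cap η)) = P.ident η 2 := by
      have : layer η ε 0 1 2 2 (P.comp (layer η ε 1 0 1 3 (P.cup ε))
          (layer η η 0 1 3 1 (P.cap η))) =
          P.comp (layer η ε 1 1 2 4 (P.cup ε)) (layer η η 0 2 4 2 (P.cap η)) :=
        layer_comp_eq (fun _ => layer_layer rfl rfl _) fun _ _ => layer_layer rfl rfl _
      rw [← this, zigzag_layer (opp_symm h), layer_ident]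
    rw [layer_zero_zero] at e1
    rw [e0, P.comp_assoc, e1, comp_comp_cancel e2]
  rw [← key k, hk, key]

theorem bend_comm (h : η = !ε) {x : P.Hom ε 2 2} {c : P.Hom ε 1 1}
    (hc : P.comp x (layer ε η 0 1 2 2 c) = P.comp (layer ε η 0 1 2 2 c) x) :
    P.comp (layer ε η 0 2 3 3 c) (bend η h x) = P.comp (bend η h x) c := by
  have e0 : layer ε ε 0 1 3 3 (P.comp x (layer ε η 0 1 2 2 c)) =
      P.comp (layer ε ε 0 1 3 3 x) (layer ε η 0 2 3 3 c) :=
    layer_comp_eq (fun _ => rfl) fun _ _ => layer_layer rfl rfl _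
  have e0' : layer ε ε 0 1 3 3 (P.comp (layer ε η 0 1 2 2 c) x) =
      P.comp (layer ε η 0 2 3 3 c) (layer ε ε 0 1 3 3 x) :=
    layer_comp_eq (fun _ => layer_layer rfl rfl _) fun _ _ => rfl
  have e1 : P.comp (layer ε η 0 2 3 3 c) (layer ε η 1 0 3 1 (P.cap η)) =
      P.comp (layer ε η 1 0 3 1 (P.cap η)) (layer ε η 0 0 1 1 c) := layer_comm 0
  rw [layer_zero_zero] at e1
  rw [bend, ← P.comp_assoc, ← e0', ← hc, e0, P.comp_assoc, e1, P.comp_assoc]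

theorem comm_of_bend_comm (h : η = !ε) {x : P.Hom ε 2 2} {c : P.Hom ε 1 1}
    (hc : P.comp (layer ε η 0 2 3 3 c) (bend η h x) = P.comp (bend η h x) c) :
    P.comp x (layer ε η 0 1 2 2 c) = P.comp (layer ε η 0 1 2 2 c) x := by
  have e0 : layer ε η 0 1 4 2 (P.comp (bend η h x) c) =
      P.comp (layer ε η 0 1 4 2 (bend η h x)) (layer ε η 0 1 2 2 c) :=
    layer_comp_eq (fun _ => rfl) fun _ _ => rfl
  have e0' : layer ε η 0 1 4 2 (P.comp (layer ε η 0 2 3 3 c) (bend η h x)) =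
      P.comp (layer ε η 0 3 4 4 c) (layer ε η 0 1 4 2 (bend η h x)) :=
    layer_comp_eq (fun _ => layer_layer rfl rfl _) fun _ _ => rfl
  have e1 : P.comp (layer ε ε 2 0 2 4 (P.cup ε)) (layer ε η 0 3 4 4 c) =
      P.comp (layer ε η 0 1 2 2 c) (layer ε ε 2 0 2 4 (P.cup ε)) := (layer_comm 1).symm
  conv_lhs => rw [← eq_cup_bend h x]
  rw [P.comp_assoc, ← e0, ← hc, e0', comp_comp_congr e1, eq_cup_bend]

/-- Placed after `a`, the box `c` sits on the left string of `x` and leaves through the upper end.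
-/
theorem convLeft_mul (h : η = !ε) {x : P.Hom ε 2 2} {c : P.Hom ε 1 1}
    (hc : P.comp x (layer ε η 0 1 2 2 c) = P.comp (layer ε η 0 1 2 2 c) x) (a : P.Hom ε 1 1) :
    (convLeft (P := P) h (P.comp a c) (fourier (P := P) h x) : P.Hom ε 1 1) =
      P.comp (convLeft (P := P) h a (fourier (P := P) h x)) c := by
  have e0 : layer ε η 0 2 3 3 (P.comp a c) =
      P.comp (layer ε η 0 2 3 3 a) (layer ε η 0 2 3 3 c) :=
    layer_comp_eq (fun _ => rfl) fun _ _ => rfl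
  rw [convLeft_fourier, convLeft_fourier, e0, P.comp_assoc, bend_comm h hc, P.comp_assoc,
    P.comp_assoc]

/-- The box `c` slides through the cup and becomes its conjugate `d`, passes along the right string
of `x`, turns back into `c` at the cap, and descends to the lower end. -/
theorem mul_convLeft (h : η = !ε) {x : P.Hom ε 2 2} {c : P.Hom ε 1 1}
    (hc : P.comp x (layer ε ε 1 0 2 2 (conj (P := P) h c)) =
      P.comp (layer ε ε 1 0 2 2 (conj (P := P) h c)) x) (a : P.Hom ε 1 1) :
    (convLeft (P := P) h (P.comp c a) (fourier (P := P) h x) : P.Hom ε 1 1) =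
      P.comp c (convLeft (P := P) h a (fourier (P := P) h x)) := by
  obtain ⟨d, hd⟩ : ∃ d : P.Hom η 1 1, d = conj (P := P) h c := ⟨_, rfl⟩
  have hcup := cup_slide h c
  have hcap := cap_slide h c
  rw [← hd] at hc hcup hcap
  have e0 : layer ε η 0 2 3 3 (P.comp c a) =
      P.comp (layer ε η 0 2 3 3 c) (layer ε η 0 2 3 3 a) :=
    layer_comp_eq (fun _ => rfl) fun _ _ => rfl
  have e1 : P.comp (layer ε ε 0 1 1 3 (P.cup ε)) (layer ε η 0 2 3 3 c) =
      P.comp (layer ε ε 0 1 1 3 (P.cup ε)) (layer ε ε 1 1 3 3 d) := by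
    have l : layer ε ε 0 1 1 3 (P.comp (P.cup ε) (layer ε η 0 1 2 2 c)) =
        P.comp (layer ε ε 0 1 1 3 (P.cup ε)) (layer ε η 0 2 3 3 c) :=
      layer_comp_eq (fun _ => rfl) fun _ _ => layer_layer rfl rfl _
    have r : layer ε ε 0 1 1 3 (P.comp (P.cup ε) (layer ε ε 1 0 2 2 d)) =
        P.comp (layer ε ε 0 1 1 3 (P.cup ε)) (layer ε ε 1 1 3 3 d) :=
      layer_comp_eq (fun _ => rfl) fun _ _ => layer_layer rfl rfl _
    rw [← l, hcup, r]
  have e2 : P.comp (layer ε ε 1 1 3 3 d) (layer ε η 0 2 3 3 a) =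
      P.comp (layer ε η 0 2 3 3 a) (layer ε ε 1 1 3 3 d) := (layer_comm 0).symm
  have e3 : P.comp (layer ε ε 1 1 3 3 d) (layer ε ε 0 1 3 3 x) =
      P.comp (layer ε ε 0 1 3 3 x) (layer ε ε 1 1 3 3 d) := by
    have l : layer ε ε 0 1 3 3 (P.comp (layer ε ε 1 0 2 2 d) x) =
        P.comp (layer ε ε 1 1 3 3 d) (layer ε ε 0 1 3 3 x) :=
      layer_comp_eq (fun _ => layer_layer rfl rfl _) fun _ _ => rfl
    have r : layer ε ε 0 1 3 3 (P.comp x (layer ε ε 1 0 2 2 d)) =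
        P.comp (layer ε ε 0 1 3 3 x) (layer ε ε 1 1 3 3 d) :=
      layer_comp_eq (fun _ => rfl) fun _ _ => layer_layer rfl rfl _
    rw [← l, ← hc, r]
  have e4 : P.comp (layer ε ε 1 1 3 3 d) (layer ε η 1 0 3 1 (P.cap η)) =
      P.comp (layer ε η 2 0 3 3 c) (layer ε η 1 0 3 1 (P.cap η)) := by
    have l : layer ε η 1 0 3 1 (P.comp (layer η ε 0 1 2 2 d) (P.cap η)) =
        P.comp (layer ε ε 1 1 3 3 d) (layer ε η 1 0 3 1 (P.cap η)) :=
      layer_comp_eq (fun _ => layer_layer rfl rfl _) fun _ _ => rfl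
    have r : layer ε η 1 0 3 1 (P.comp (layer η η 1 0 2 2 c) (P.cap η)) =
        P.comp (layer ε η 2 0 3 3 c) (layer ε η 1 0 3 1 (P.cap η)) :=
      layer_comp_eq (fun _ => layer_layer rfl rfl _) fun _ _ => rfl
    rw [← l, ← hcap, r]
  have e5 : P.comp (layer ε ε 0 1 3 3 x) (layer ε η 2 0 3 3 c) =
      P.comp (layer ε η 2 0 3 3 c) (layer ε ε 0 1 3 3 x) := layer_comm 0
  have e6 : P.comp (layer ε η 0 2 3 3 a) (layer ε η 2 0 3 3 c) =
      P.comp (layer ε η 2 0 3 3 c) (layer ε η 0 2 3 3 a) := layer_comm 1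
  have e7 : P.comp (layer ε ε 0 1 1 3 (P.cup ε)) (layer ε η 2 0 3 3 c) =
      P.comp (layer ε η 0 0 1 1 c) (layer ε ε 0 1 1 3 (P.cup ε)) := layer_comm 0
  rw [layer_zero_zero] at e7
  rw [convLeft_fourier, convLeft_fourier, e0, P.comp_assoc, comp_comp_congr e1,
    comp_comp_congr e2, bend, comp_comp_congr e3, e4, comp_comp_congr e5, comp_comp_congr e6,
    comp_comp_congr e7]

/-- A box that can be moved from the source of the first string of `x̂` to that of the second
commutes with `x` on its right string. -/
theorem comm_conj_of_fourier (h : η = !ε) {x : P.Hom ε 2 2} {c : P.Hom ε 1 1}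
    (hc : P.comp c (P.comp (layer ε ε 0 1 1 3 (P.cup ε))
        (layer ε η 1 0 3 3 (fourier (P := P) h x))) =
      P.comp (P.comp (layer ε ε 0 1 1 3 (P.cup ε)) (layer ε η 1 0 3 3 (fourier (P := P) h x)))
        (layer ε η 0 2 3 3 c)) :
    P.comp x (layer ε ε 1 0 2 2 (conj (P := P) h c)) =
      P.comp (layer ε ε 1 0 2 2 (conj (P := P) h c)) x := by
  obtain ⟨d, hd⟩ : ∃ d : P.Hom η 1 1, d = conj (P := P) h c := ⟨_, rfl⟩
  obtain ⟨k, hk⟩ : ∃ k : P.Hom η 2 2, k = fourier (P := P) h x := ⟨_, rfl⟩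
  have hcup := cup_slide h c
  have hx := eq_cup_fourier_cap h x
  rw [← hd] at hcup ⊢
  rw [← hk] at hc hx
  have e1 : P.comp (layer ε ε 0 1 1 3 (P.cup ε)) (layer ε η 0 2 3 3 c) =
      P.comp (layer ε ε 0 1 1 3 (P.cup ε)) (layer ε ε 1 1 3 3 d) := by
    have l : layer ε ε 0 1 1 3 (P.comp (P.cup ε) (layer ε η 0 1 2 2 c)) =
        P.comp (layer ε ε 0 1 1 3 (P.cup ε)) (layer ε η 0 2 3 3 c) :=
      layer_comp_eq (fun _ => rfl) fun _ _ => layer_layer rfl rfl _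
    have r : layer ε ε 0 1 1 3 (P.comp (P.cup ε) (layer ε ε 1 0 2 2 d)) =
        P.comp (layer ε ε 0 1 1 3 (P.cup ε)) (layer ε ε 1 1 3 3 d) :=
      layer_comp_eq (fun _ => rfl) fun _ _ => layer_layer rfl rfl _
    rw [← l, hcup, r]
  have e2 : P.comp (layer ε η 1 0 3 3 k) (layer ε η 0 2 3 3 c) =
      P.comp (layer ε η 0 2 3 3 c) (layer ε η 1 0 3 3 k) := (layer_comm 0).symm
  have e3 : P.comp (layer ε ε 0 1 1 3 (P.cup ε)) (layer ε η 2 0 3 3 c) =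
      P.comp (layer ε η 0 0 1 1 c) (layer ε ε 0 1 1 3 (P.cup ε)) := layer_comm 0
  rw [layer_zero_zero] at e3
  -- Below `x̂`, the box `c` on the right string equals its conjugate on the left. Drawing `x` as
  -- `x̂` with bent strings, this carries `d` from the lower right string over to the cup and then
  -- up the right-hand side.
  have hmove : P.comp (layer η η 1 0 2 2 c) k = P.comp (layer η ε 0 1 2 2 d) k := by
    apply cup_comp_injective h
    have l : layer ε η 1 0 3 3 (P.comp (layer η η 1 0 2 2 c) k) =
        P.comp (layer ε η 2 0 3 3 c) (layer ε η 1 0 3 3 k) :=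
      layer_comp_eq (fun _ => layer_layer rfl rfl _) fun _ _ => rfl
    have r : layer ε η 1 0 3 3 (P.comp (layer η ε 0 1 2 2 d) k) =
        P.comp (layer ε ε 1 1 3 3 d) (layer ε η 1 0 3 3 k) :=
      layer_comp_eq (fun _ => layer_layer rfl rfl _) fun _ _ => rfl
    rw [l, r, comp_comp_congr e3, hc, P.comp_assoc, e2, comp_comp_congr e1]
  have f1 : P.comp (layer ε ε 1 0 2 2 d) (layer ε ε 2 0 2 4 (P.cup ε)) =
      P.comp (layer ε ε 2 0 2 4 (P.cup ε)) (layer ε ε 1 2 4 4 d) := layer_comm 0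
  have f2 : P.comp (layer ε ε 1 2 4 4 d) (layer ε η 1 1 4 4 k) =
      P.comp (layer ε η 2 1 4 4 c) (layer ε η 1 1 4 4 k) := by
    have l : layer ε η 1 1 4 4 (P.comp (layer η ε 0 1 2 2 d) k) =
        P.comp (layer ε ε 1 2 4 4 d) (layer ε η 1 1 4 4 k) :=
      layer_comp_eq (fun _ => layer_layer rfl rfl _) fun _ _ => rfl
    have r : layer ε η 1 1 4 4 (P.comp (layer η η 1 0 2 2 c) k) =
        P.comp (layer ε η 2 1 4 4 c) (layer ε η 1 1 4 4 k) :=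
      layer_comp_eq (fun _ => layer_layer rfl rfl _) fun _ _ => rfl
    rw [← l, ← hmove, r]
  have f3 : P.comp (layer ε ε 2 0 2 4 (P.cup ε)) (layer ε η 2 1 4 4 c) =
      P.comp (layer ε ε 2 0 2 4 (P.cup ε)) (layer ε ε 3 0 4 4 d) := by
    have l : layer ε ε 2 0 2 4 (P.comp (P.cup ε) (layer ε η 0 1 2 2 c)) =
        P.comp (layer ε ε 2 0 2 4 (P.cup ε)) (layer ε η 2 1 4 4 c) :=
      layer_comp_eq (fun _ => rfl) fun _ _ => layer_layer rfl rfl _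
    have r : layer ε ε 2 0 2 4 (P.comp (P.cup ε) (layer ε ε 1 0 2 2 d)) =
        P.comp (layer ε ε 2 0 2 4 (P.cup ε)) (layer ε ε 3 0 4 4 d) :=
      layer_comp_eq (fun _ => rfl) fun _ _ => layer_layer rfl rfl _
    rw [← l, hcup, r]
  have f4 : P.comp (layer ε ε 3 0 4 4 d) (layer ε η 1 1 4 4 k) =
      P.comp (layer ε η 1 1 4 4 k) (layer ε ε 3 0 4 4 d) := (layer_comm 0).symm
  have f5 : P.comp (layer ε ε 3 0 4 4 d) (layer ε ε 0 2 4 2 (P.cap ε)) =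
      P.comp (layer ε ε 0 2 4 2 (P.cap ε)) (layer ε ε 1 0 2 2 d) := (layer_comm 1).symm
  conv_rhs => rw [← hx]
  rw [comp_comp_congr f1, comp_comp_congr f2, comp_comp_congr f3, comp_comp_congr f4, f5]
  conv_lhs => rw [← hx]
  simp only [P.comp_assoc]

end CStarPlanarAlgebra

/-! ### A positivity criterion by compression. -/

namespace FiniteCStar

variable {A : Type*} [CStarAlgebra A] [FiniteDimensional ℂ A] [PartialOrder A] [StarOrderedRing A]

/-- A self-adjoint element is positive if compressions of it can be minus a square only
trivially. -/
theorem nonneg_of_forall_compression {a : A} (ha : IsSelfAdjoint a)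
    (h : ∀ b d : A, IsSelfAdjoint b → b * a * b = -(d * star d) → d = 0) : 0 ≤ a := by
  -- With `b` the negative part of `a`, one has `b a b = -b³ = -d d*` for `d = b^(3/2)`.
  obtain ⟨b, hb⟩ : ∃ b, b = cfc (fun t : ℝ => max (-t) 0) a := ⟨_, rfl⟩
  obtain ⟨d, hd⟩ : ∃ d, d = cfc (fun t : ℝ => max (-t) 0 * √(max (-t) 0)) a := ⟨_, rfl⟩
  have hbs : IsSelfAdjoint b := hb ▸ cfc_predicate _ a
  have hds : star d = d := by rw [hd]; exact cfc_predicate (R := ℝ) _ a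
  have hdd : d * d = b * b * b := by
    rw [hd, hb, cfc_mul_cfc, cfc_mul_cfc, cfc_mul_cfc]
    congr 1; ext t
    have := Real.mul_self_sqrt (le_max_right (-t) 0)
    linear_combination max (-t) 0 * max (-t) 0 * this
  have hbab : b * a * b = -(b * b * b) := by
    have : b * cfc (fun t : ℝ => t) a * b = -(b * b * b) := by
      rw [hb, cfc_mul_cfc, cfc_mul_cfc, cfc_mul_cfc, cfc_mul_cfc, ← cfc_neg]
      congr 1; ext t
      rcases le_total t 0 with ht | ht
      · rw [max_eq_left (neg_nonneg.2 ht)]; ring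
      · rw [max_eq_right (neg_nonpos.2 ht)]; ring
    rwa [cfc_id' ℝ a ha] at this
  have hd0 : d = 0 := h b d hbs (by rw [hbab, hds, hdd])
  have hb3 : b * b * b = 0 := by rw [← hdd, hd0, zero_mul]
  have hb2 : b * b = 0 := by
    have : (b * b) * star (b * b) = 0 := by
      rw [star_mul, hbs.star_eq, ← mul_assoc, hb3, zero_mul]
    exact CStarRing.mul_star_self_eq_zero_iff _ |>.1 this
  have hb0 : b = 0 := by
    have : b * star b = 0 := by rw [hbs.star_eq, hb2]
    exact CStarRing.mul_star_self_eq_zero_iff _ |>.1 this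
  have hab : cfc (fun t : ℝ => t) a = cfc (fun t : ℝ => max t 0) a - b := by
    rw [hb, ← cfc_sub _ _ a (continuousOn_spectrum _ _) (continuousOn_spectrum _ _)]
    congr 1; ext t
    rcases le_total t 0 with ht | ht
    · rw [max_eq_right ht, max_eq_left (neg_nonneg.2 ht)]; ring
    · rw [max_eq_left ht, max_eq_right (neg_nonpos.2 ht)]; ring
  rw [cfc_id' ℝ a ha, hb0, sub_zero] at hab
  rw [hab]
  exact cfc_nonneg fun t _ => le_max_right t 0

end FiniteCStar

/-! ### The invariant functional given by a right eigenvector. -/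

namespace CStarPlanarAlgebra
open PlanarStarAlgebra

variable {P : CStarPlanarAlgebra.{u}} {ε η : Shading}

/-- The closed picture with `a` on the left and `z` on the right of a circle. -/
def pairing (h : η = !ε) (z : P.Hom η 1 1) : P.Box ε 1 →ₗ[ℂ] P.Box ε 0 where
  toFun a := P.comp (P.cup ε)
    (P.comp (layer ε η 0 1 2 2 (a : P.Hom ε 1 1)) (P.comp (layer ε ε 1 0 2 2 z) (P.cap ε)))
  map_add' a b := by
    have := layer_add (h := shade_zero ε) (h' := shade_one_of h) (hm := (rfl : 0 + (1 + 1) = 2))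
      (hn := rfl) (a : P.Hom ε 1 1) b
    refine (congrArg (fun l => P.comp (P.cup ε) (P.comp l _)) this).trans ?_
    rw [map_add, LinearMap.add_apply, map_add]
    rfl
  map_smul' c a := by
    have := layer_smul (h := shade_zero ε) (h' := shade_one_of h) (hm := (rfl : 0 + (1 + 1) = 2))
      (hn := rfl) c (a : P.Hom ε 1 1)
    refine (congrArg (fun l => P.comp (P.cup ε) (P.comp l _)) this).trans ?_
    rw [map_smul, LinearMap.smul_apply, map_smul]
    rfl

theorem pairing_apply (h : η = !ε) (z : P.Hom η 1 1) (a : P.Hom ε 1 1) :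
    pairing h z a = P.comp (P.cup ε)
      (P.comp (layer ε η 0 1 2 2 a) (P.comp (layer ε ε 1 0 2 2 z) (P.cap ε))) := rfl

/-- Both sides are the same closed picture, with `k` between `a` and `z`. Thus left and right
convolution are transposes of each other, and a right eigenvector yields an invariant functional. -/
theorem pairing_convLeft (h : η = !ε) (z : P.Hom η 1 1) (a : P.Hom ε 1 1) (k : P.Hom η 2 2) :
    pairing h z (convLeft (P := P) h a k) = pairing h (convRight (P := P) h k z) a := by
  rw [pairing_apply h (convRight (P := P) h k z) a]
  refine (pairing_apply h z (convLeft (P := P) h a k)).trans ?_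
  have e0 : layer ε η 0 1 2 2 (convLeft (P := P) h a k : P.Hom ε 1 1) =
      P.comp (layer ε ε 0 2 2 4 (P.cup ε)) (P.comp (layer ε η 0 3 4 4 a)
        (P.comp (layer ε η 1 1 4 4 k) (layer ε ε 0 2 4 2 (P.cap ε)))) := by
    rw [convLeft_eq h a k]
    exact layer_comp_eq (fun _ => layer_layer rfl rfl _) fun _ _ =>
      layer_comp_eq (fun _ => layer_layer rfl rfl _) fun _ _ =>
      layer_comp_eq (fun _ => layer_layer rfl rfl _) fun _ _ => layer_layer rfl rfl _
  have e0' : layer ε ε 1 0 2 2 (convRight (P := P) h k z : P.Hom η 1 1) =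
      P.comp (layer ε ε 2 0 2 4 (P.cup ε)) (P.comp (layer ε η 1 1 4 4 k)
        (P.comp (layer ε ε 3 0 4 4 z) (layer ε ε 2 0 4 2 (P.cap ε)))) := by
    rw [convRight_eq h k z]
    exact layer_comp_eq (fun _ => layer_layer rfl rfl _) fun _ _ =>
      layer_comp_eq (fun _ => layer_layer rfl rfl _) fun _ _ =>
      layer_comp_eq (fun _ => layer_layer rfl rfl _) fun _ _ => layer_layer rfl rfl _
  have f1 : P.comp (layer ε ε 0 0 0 2 (P.cup ε)) (layer ε ε 2 0 2 4 (P.cup ε)) =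
      P.comp (layer ε ε 0 0 0 2 (P.cup ε)) (layer ε ε 0 2 2 4 (P.cup ε)) := layer_comm 0
  have f2 : P.comp (layer ε ε 2 0 2 4 (P.cup ε)) (layer ε η 0 3 4 4 a) =
      P.comp (layer ε η 0 1 2 2 a) (layer ε ε 2 0 2 4 (P.cup ε)) := (layer_comm 1).symm
  have f3 : P.comp (layer ε ε 0 2 4 2 (P.cap ε)) (layer ε ε 1 0 2 2 z) =
      P.comp (layer ε ε 3 0 4 4 z) (layer ε ε 0 2 4 2 (P.cap ε)) := layer_comm 1
  have f4 : P.comp (layer ε ε 0 2 4 2 (P.cap ε)) (layer ε ε 0 0 2 0 (P.cap ε)) =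
      P.comp (layer ε ε 2 0 4 2 (P.cap ε)) (layer ε ε 0 0 2 0 (P.cap ε)) := layer_comm 0
  rw [layer_zero_zero] at f1 f4
  rw [e0, e0']
  simp only [P.comp_assoc]
  rw [← comp_comp_congr f1, comp_comp_congr f2, comp_comp_congr f3, f4]

theorem pairing_mul (h : η = !ε) {z q : P.Hom η 1 1} (hq : P.comp z q = z) (a : P.Hom ε 1 1) :
    pairing h z (P.comp a (conj (P := P) (opp_symm h) q)) = pairing h z a := by
  rw [pairing_apply h z a]
  refine (pairing_apply h z (P.comp a (conj (P := P) (opp_symm h) q))).trans ?_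
  obtain ⟨d, hd⟩ : ∃ d : P.Hom ε 1 1, d = conj (P := P) (opp_symm h) q := ⟨_, rfl⟩
  have hcap := cap_slide (opp_symm h) q
  rw [← hd] at hcap ⊢
  have e0 : layer ε η 0 1 2 2 (P.comp a d) =
      P.comp (layer ε η 0 1 2 2 a) (layer ε η 0 1 2 2 d) :=
    layer_comp_eq (fun _ => rfl) fun _ _ => rfl
  have e1 : P.comp (layer ε η 0 1 2 2 d) (layer ε ε 1 0 2 2 z) =
      P.comp (layer ε ε 1 0 2 2 z) (layer ε η 0 1 2 2 d) := layer_comm 0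
  have e2 : P.comp (layer ε ε 1 0 2 2 z) (layer ε ε 1 0 2 2 q) = layer ε ε 1 0 2 2 z := by
    have : layer ε ε 1 0 2 2 (P.comp z q) =
        P.comp (layer ε ε 1 0 2 2 z) (layer ε ε 1 0 2 2 q) :=
      layer_comp_eq (fun _ => rfl) fun _ _ => rfl
    rw [← this, hq]
  rw [e0, P.comp_assoc, comp_comp_congr e1, ← hcap, ← P.comp_assoc _ _ (P.cap ε), e2]

theorem layer_cap_eq (h : η = !ε) (m : P.Hom ε 1 1) :
    P.comp (layer ε η 1 0 1 3 (P.cup η))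
      (layer ε ε 0 1 3 1 (P.comp (layer ε η 0 1 2 2 m) (P.cap ε))) = m := by
  have e0 : layer ε ε 0 1 3 1 (P.comp (layer ε η 0 1 2 2 m) (P.cap ε)) =
      P.comp (layer ε η 0 2 3 3 m) (layer ε ε 0 1 3 1 (P.cap ε)) :=
    layer_comp_eq (fun _ => layer_layer rfl rfl _) fun _ _ => rfl
  have e1 : P.comp (layer ε η 1 0 1 3 (P.cup η)) (layer ε η 0 2 3 3 m) =
      P.comp (layer ε η 0 0 1 1 m) (layer ε η 1 0 1 3 (P.cup η)) := (layer_comm 0).symm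
  rw [layer_zero_zero] at e1
  rw [e0, comp_comp_congr e1, zigzag_layer h, P.comp_ident]

theorem eq_zero_of_layer_cap (h : η = !ε) {m : P.Hom ε 1 1}
    (hm : P.comp (layer ε η 0 1 2 2 m) (P.cap ε) = 0) : m = 0 := by
  rw [← layer_cap_eq h m, hm, layer_zero, map_zero]

/-- Pictures from two points to none have no isotropic vectors. -/
theorem layer_cap_eq_zero (h : η = !ε) {m : P.Hom ε 1 1} {f : P.Hom ε 2 0}
    (hf : f = P.comp (layer ε η 0 1 2 2 m) (P.cap ε)) (h0 : P.comp (P.dagger f) f = 0) : f = 0 := by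
  -- Adding a cup on top makes a `2`-box, where the C*-identity applies; the cup is removed again by
  -- straightening.
  have h1 : P.comp f (P.cup ε) = 0 := by
    obtain ⟨z, hz⟩ : ∃ z : P.Box ε 2, z = P.comp f (P.cup ε) := ⟨_, rfl⟩
    have h2 : star z * z = 0 := by
      have : star z * z = P.comp (P.dagger (P.comp f (P.cup ε))) (P.comp f (P.cup ε)) := by
        rw [hz]; rfl
      rw [this, P.dagger_comp, P.comp_assoc, ← P.comp_assoc _ f, h0, map_zero,
        LinearMap.zero_apply, map_zero]
      rfl
    rw [← hz]
    exact (CStarRing.star_mul_self_eq_zero_iff z).1 h2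
  have h3 : layer ε ε 0 1 3 1 f = 0 := by
    have e : layer ε ε 0 1 3 3 (P.comp f (P.cup ε)) =
        P.comp (layer ε ε 0 1 3 1 f) (layer ε ε 0 1 1 3 (P.cup ε)) :=
      layer_comp_eq (fun _ => rfl) fun _ _ => rfl
    rw [h1, layer_zero] at e
    have := congrArg (fun l => P.comp l (layer ε η 1 0 3 1 (P.cap η))) e.symm
    simpa only [P.comp_assoc, zigzag_layer' h, P.comp_ident, map_zero, LinearMap.zero_apply]
      using this
  have h4 : m = 0 := by rw [← layer_cap_eq h m, ← hf, h3, map_zero]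
  rw [hf, h4, layer_zero, map_zero, LinearMap.zero_apply]

/-- The pairing is `f† f`, where `f` is the cap with `a†` and `t†` on its two legs, so `f = 0`.
Sliding the right leg through the cap turns this into an identity of `1`-boxes. Values in the
`0`-boxes suffice and no trace is involved. -/
theorem mul_conj_eq_zero (h : η = !ε) {t g : P.Hom η 1 1} {a : P.Hom ε 1 1}
    (ha : pairing h (P.comp t (P.dagger t)) (P.comp a (P.dagger a)) = (0 : P.Hom ε 0 0)) :
    P.comp (P.dagger a) (conj (P := P) (opp_symm h) (P.comp g (P.dagger t))) =
      (0 : P.Hom ε 1 1) := by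
  obtain ⟨b, hb⟩ : ∃ b, b = P.dagger a := ⟨_, rfl⟩
  obtain ⟨s, hs⟩ : ∃ s, s = P.dagger t := ⟨_, rfl⟩
  have hba : P.dagger b = a := by rw [hb, P.dagger_dagger]
  have hst : P.dagger s = t := by rw [hs, P.dagger_dagger]
  rw [← hb, ← hs] at ha
  rw [← hb, ← hs]
  have c1 : ∀ (v : P.Hom ε 1 1) (w : P.Hom η 1 1),
      P.comp (layer ε η 0 1 2 2 v) (layer ε ε 1 0 2 2 w) =
      P.comp (layer ε ε 1 0 2 2 w) (layer ε η 0 1 2 2 v) := fun v w => layer_comm 0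
  have m1 : ∀ v w : P.Hom ε 1 1, layer ε η 0 1 2 2 (P.comp v w) =
      P.comp (layer ε η 0 1 2 2 v) (layer ε η 0 1 2 2 w) := fun v w =>
    layer_comp_eq (fun _ => rfl) fun _ _ => rfl
  have m2 : ∀ v w : P.Hom η 1 1, layer ε ε 1 0 2 2 (P.comp v w) =
      P.comp (layer ε ε 1 0 2 2 v) (layer ε ε 1 0 2 2 w) := fun v w =>
    layer_comp_eq (fun _ => rfl) fun _ _ => rfl
  have hslide : ∀ w : P.Hom η 1 1, P.comp (layer ε ε 1 0 2 2 w) (P.cap ε) =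
      P.comp (layer ε η 0 1 2 2 (conj (P := P) (opp_symm h) w)) (P.cap ε) :=
    cap_slide (opp_symm h)
  obtain ⟨f, hf⟩ : ∃ f, f = P.comp (layer ε η 0 1 2 2 b)
      (P.comp (layer ε ε 1 0 2 2 s) (P.cap ε)) := ⟨_, rfl⟩
  have hf0 : f = 0 := by
    refine layer_cap_eq_zero h (m := P.comp b (conj (P := P) (opp_symm h) s)) ?_ ?_
    · rw [hf, hslide]
      refine Eq.trans ?_ (congrArg (fun l => P.comp l (P.cap ε)) (m1 _ _).symm)
      rw [P.comp_assoc]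
    · have hd : P.dagger f = P.comp (P.cup ε)
          (P.comp (layer ε ε 1 0 2 2 t) (layer ε η 0 1 2 2 a)) := by
        rw [hf, P.dagger_comp, P.dagger_comp, dagger_cap, dagger_layer, dagger_layer, hba, hst,
          P.comp_assoc]
      rw [hd, hf, ← c1]
      rw [pairing_apply, m1, m2] at ha
      simp only [P.comp_assoc] at ha ⊢
      rw [comp_comp_congr (c1 b t)] at ha
      exact ha
  apply eq_zero_of_layer_cap h
  refine (congrArg (fun l => P.comp l (P.cap ε)) (m1 _ _)).trans ?_
  rw [P.comp_assoc, ← hslide, m2, P.comp_assoc, comp_comp_congr (c1 b g), ← hf, hf0, map_zero]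

end CStarPlanarAlgebra

/-! ### Positivity of `v v†` for pictures with one lower and three upper points. -/

namespace CStarPlanarAlgebra
open PlanarStarAlgebra MulOpposite

variable {P : CStarPlanarAlgebra.{u}} {ε η : Shading}

theorem ident_zero_tensor_cup {θ : Shading} (hθ : shade ε 0 = θ) :
    (P.tensor hθ (P.ident ε 0) (P.cup θ) : P.Hom ε 0 2) = P.cup ε := by
  obtain rfl : ε = θ := by rw [← hθ, shade_zero]
  exact eq_of_heq (P.empty_tensor _)

theorem ident_zero_tensor_cap {θ : Shading} (hθ : shade ε 0 = θ) :
    (P.tensor hθ (P.ident ε 0) (P.cap θ) : P.Hom ε 2 0) = P.cap ε := by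
  obtain rfl : ε = θ := by rw [← hθ, shade_zero]
  exact eq_of_heq (P.empty_tensor _)

theorem closure_one (h : η = !ε) (w : P.Hom ε 1 1) :
    PlanarStarAlgebra.closure P.toPlanarStarAlgebra 1 w = pairing h (P.ident η 1) w := by
  obtain rfl : shade ε 1 = η := shade_one_of h
  rw [pairing_apply, layer_ident, P.ident_comp, ← tensor_ident_eq_layer (h := rfl)]
  have e1 := ident_zero_tensor_cup (P := P) (rfl : shade ε 0 = _)
  have e2 := ident_zero_tensor_cap (P := P) (rfl : shade ε 0 = _)
  rw [← e1, ← e2]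
  rfl

theorem closure_two (h : η = !ε) (w : P.Hom ε 2 2) :
    PlanarStarAlgebra.closure P.toPlanarStarAlgebra 2 w =
      PlanarStarAlgebra.closure P.toPlanarStarAlgebra 1 (P.comp (layer ε η 1 0 1 3 (P.cup η))
      (P.comp (layer ε ε 0 1 3 3 w) (layer ε η 1 0 3 1 (P.cap η)))) := by
  obtain rfl : shade ε 1 = η := shade_one_of h
  have e1 := ident_tensor_eq_layer (P := P.toPlanarStarAlgebra) (i := 1) (rfl : shade ε 1 = _)
    (h' := shade_zero _) (P.cup (shade ε 1))
  have e2 : ∀ (θ : Shading) (hθ : shade ε 2 = θ),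
      P.tensor (a := 2) (b := 2) rfl w (P.ident (shade ε 2) 1) =
        layer ε θ 0 1 3 3 w (shade_zero _) hθ := by
    rintro _ rfl
    exact tensor_ident_eq_layer w
  have e3 := ident_tensor_eq_layer (P := P.toPlanarStarAlgebra) (i := 1) (rfl : shade ε 1 = _)
    (h' := shade_two _) (P.cap (shade ε 1))
  rw [← e2 ε (shade_two ε), ← e1, ← e3]
  rfl

/-- The picture `v` with its rightmost upper string bent down. -/
def fold (h : η = !ε) (v : P.Hom ε 1 3) : P.Hom ε 2 2 :=
  P.comp (layer ε η 0 1 2 4 v) (layer ε ε 2 0 4 2 (P.cap ε))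

theorem cup_fold (h : η = !ε) (v : P.Hom ε 1 3) :
    P.comp (layer ε η 1 0 1 3 (P.cup η)) (layer ε ε 0 1 3 3 (fold h v)) = v := by
  have e0 : layer ε ε 0 1 3 3 (fold h v) =
      P.comp (layer ε η 0 2 3 5 v) (layer ε ε 2 1 5 3 (P.cap ε)) :=
    layer_comp_eq (fun _ => layer_layer rfl rfl _) fun _ _ => layer_layer rfl rfl _
  have e1 : P.comp (layer ε η 1 0 1 3 (P.cup η)) (layer ε η 0 2 3 5 v) =
      P.comp (layer ε η 0 0 1 3 v) (layer ε η 3 0 3 5 (P.cup η)) := (layer_comm 0).symm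
  have e2 : P.comp (layer ε η 3 0 3 5 (P.cup η)) (layer ε ε 2 1 5 3 (P.cap ε)) = P.ident ε 3 := by
    have : layer ε η 2 0 3 3 (P.comp (layer ε η 1 0 1 3 (P.cup η)) (layer ε ε 0 1 3 1 (P.cap ε))) =
        P.comp (layer ε η 3 0 3 5 (P.cup η)) (layer ε ε 2 1 5 3 (P.cap ε)) :=
      layer_comp_eq (fun _ => layer_layer rfl rfl _) fun _ _ => layer_layer rfl rfl _
    rw [← this, zigzag_layer h, layer_ident]
  rw [layer_zero_zero] at e1
  rw [e0, comp_comp_congr e1, e2, P.comp_ident]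

/-- Closing the right string of the `2`-box unfolds the bent string. Traces of `v v†` are thereby
traces of squares of `2`-boxes, hence nonnegative. -/
theorem closure_fold (h : η = !ε) (v : P.Hom ε 1 3) :
    PlanarStarAlgebra.closure P.toPlanarStarAlgebra 2 (P.comp (fold h v) (P.dagger (fold h v))) =
      PlanarStarAlgebra.closure P.toPlanarStarAlgebra 1 (P.comp v (P.dagger v)) := by
  obtain ⟨w, hw⟩ : ∃ w, w = fold h v := ⟨_, rfl⟩
  have h1 := cup_fold h v
  rw [← hw] at h1
  have h2 : P.comp (layer ε ε 0 1 3 3 (P.dagger w)) (layer ε η 1 0 3 1 (P.cap η)) =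
      P.dagger v := by
    rw [← h1, P.dagger_comp, dagger_layer, dagger_layer, P.dagger_cup]
  have h3 : layer ε ε 0 1 3 3 (P.comp w (P.dagger w)) =
      P.comp (layer ε ε 0 1 3 3 w) (layer ε ε 0 1 3 3 (P.dagger w)) :=
    layer_comp_eq (fun _ => rfl) fun _ _ => rfl
  rw [← hw]
  refine (closure_two h (P.comp w (P.dagger w))).trans ?_
  rw [h3, P.comp_assoc, h2, ← P.comp_assoc, h1]

theorem eq_zero_of_comp_dagger (h : η = !ε) {v : P.Hom ε 1 3} (hv : P.comp v (P.dagger v) = 0) :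
    v = 0 := by
  have h0 : fold h v = 0 := by
    by_contra hne
    have h1 : 0 < (P.tr₀ ε (PlanarStarAlgebra.closure P.toPlanarStarAlgebra 2
        (P.comp (fold h v) (P.dagger (fold h v))))).re := (P.tr_pos (fold h v) hne).1
    rw [closure_fold h v, hv, closure_one h] at h1
    refine lt_irrefl (0 : ℝ) (h1.trans_eq ?_)
    refine (congrArg (fun a => (P.tr₀ ε a).re) (map_zero (pairing h (P.ident η 1)))).trans ?_
    rw [map_zero, Complex.zero_re]
  rw [← cup_fold h v, h0, layer_zero, map_zero]

/-- A compression `b v v† b` is of the same form, so its trace is nonnegative by folding; it cannot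
be `-d d*` with `d ≠ 0`, since the trace is faithful. -/
theorem isPos_comp_dagger (h : η = !ε) (v : P.Hom ε 1 3) :
    ∃ b : P.Box ε 1, (P.comp v (P.dagger v) : P.Hom ε 1 1) = b * star b := by
  let _ : PartialOrder (P.Box ε 1) := CStarAlgebra.spectralOrder _
  have : StarOrderedRing (P.Box ε 1) := CStarAlgebra.spectralOrderedRing _
  obtain ⟨a, ha⟩ : ∃ a : P.Box ε 1, a = P.comp v (P.dagger v) := ⟨_, rfl⟩
  have hpos : 0 ≤ a := by
    refine FiniteCStar.nonneg_of_forall_compression ?_ fun b d hb hd => ?_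
    · have : P.dagger (P.comp v (P.dagger v)) = P.comp v (P.dagger v) := by
        rw [P.dagger_comp, P.dagger_dagger]
      rw [ha]
      exact this
    · by_contra hne
      have h1 := (P.tr_pos d hne).1
      obtain ⟨w, hw⟩ : ∃ w : P.Hom ε 1 3, w = P.comp (b : P.Hom ε 1 1) v := ⟨_, rfl⟩
      have hww : P.comp w (P.dagger w) = (-(d * star d) : P.Box ε 1) := by
        have key : ∀ b : P.Hom ε 1 1, P.comp (P.comp b v) (P.dagger (P.comp b v)) =
            P.comp (P.comp b (P.comp v (P.dagger v))) (P.dagger b) := by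
          intro b
          rw [P.dagger_comp]
          simp only [P.comp_assoc]
        refine (congrArg (fun l => P.comp l (P.dagger l)) hw).trans ((key b).trans ?_)
        refine (congrArg (fun l : P.Box ε 1 => b * l * star b) ha.symm).trans ?_
        exact (congrArg (fun l : P.Box ε 1 => b * a * l) hb).trans hd
      have h2 : PlanarStarAlgebra.closure P.toPlanarStarAlgebra 2
          (P.comp (fold h w) (P.dagger (fold h w))) =
          - PlanarStarAlgebra.closure P.toPlanarStarAlgebra 1 (d * star d) := by
        refine (closure_fold h w).trans ((closure_one h _).trans ?_)
        refine (congrArg (pairing h (P.ident η 1)) hww).trans ((map_neg _ _).trans ?_)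
        exact congrArg Neg.neg (closure_one h _).symm
      have h3 : 0 ≤ (P.tr₀ ε (PlanarStarAlgebra.closure P.toPlanarStarAlgebra 2
          (P.comp (fold h w) (P.dagger (fold h w))))).re := by
        by_cases hf : fold h w = 0
        · have hw0 : P.comp w (P.dagger w) = 0 := by
            rw [← cup_fold h w, hf, layer_zero, map_zero, LinearMap.map_zero₂]
          rw [closure_fold h w, hw0, closure_one h]
          refine le_of_eq (Eq.symm ?_)
          refine (congrArg (fun a => (P.tr₀ ε a).re) (map_zero (pairing h (P.ident η 1)))).trans ?_
          rw [map_zero, Complex.zero_re]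
        · exact (P.tr_pos (fold h w) hf).1.le
      rw [h2, map_neg, Complex.neg_re] at h3
      linarith
  obtain ⟨b, hb⟩ := FiniteCStar.nonneg_iff_exists.1 hpos
  exact ⟨b, ha.symm.trans hb⟩

end CStarPlanarAlgebra

/-! ### The bimodule of pictures and the transfer operator. -/

namespace CStarPlanarAlgebra
open PlanarStarAlgebra MulOpposite

variable {P : CStarPlanarAlgebra.{u}} {ε η : Shading}

variable (P) in
/-- The pictures with one lower and three upper points, as a bimodule over the `1`-boxes, which act
on the lower string and on the first upper string. -/
def Leg (_ : η = !ε) : Type u := P.Hom ε 1 3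

namespace Leg

variable {h : η = !ε}

instance : AddCommGroup (P.Leg h) := inferInstanceAs (AddCommGroup (P.Hom ε 1 3))

instance : Module ℂ (P.Leg h) := inferInstanceAs (Module ℂ (P.Hom ε 1 3))

/-- A picture as an element of the bimodule. -/
def of (h : η = !ε) (v : P.Hom ε 1 3) : P.Leg h := v

/-- The picture underlying an element of the bimodule. -/
def pic (v : P.Leg h) : P.Hom ε 1 3 := v

/-- The `A`-valued inner product. -/
def ip (v w : P.Leg h) : P.Box ε 1 := P.comp (pic v) (P.dagger (pic w))

instance : Module (P.Box ε 1) (P.Leg h) where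
  smul a v := of h (P.comp (a : P.Hom ε 1 1) (pic v))
  one_smul v := P.ident_comp (pic v)
  mul_smul a b v := P.comp_assoc (a : P.Hom ε 1 1) (b : P.Hom ε 1 1) (pic v)
  smul_zero a := map_zero (P.comp (a : P.Hom ε 1 1))
  smul_add a v w := map_add (P.comp (a : P.Hom ε 1 1)) (pic v) (pic w)
  add_smul a b v := LinearMap.map_add₂ P.comp (a : P.Hom ε 1 1) (b : P.Hom ε 1 1) (pic v)
  zero_smul v := LinearMap.map_zero₂ P.comp (pic v)

theorem layer_mul (h : η = !ε) (v w : P.Hom ε 1 1) : layer ε η 0 2 3 3 (P.comp v w) =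
    P.comp (layer ε η 0 2 3 3 v) (layer ε η 0 2 3 3 w) :=
  layer_comp_eq (fun _ => rfl) fun _ _ => rfl

instance : Module (P.Box ε 1)ᵐᵒᵖ (P.Leg h) where
  smul a v := of h (P.comp (pic v) (layer ε η 0 2 3 3 (unop a : P.Hom ε 1 1)))
  one_smul v := (congrArg (P.comp (pic v)) layer_ident).trans (P.comp_ident (pic v))
  mul_smul a b v := (congrArg (P.comp (pic v)) (layer_mul h (unop b) (unop a))).trans
    (P.comp_assoc _ _ _).symm
  smul_zero a := LinearMap.map_zero₂ P.comp _
  smul_add a v w := LinearMap.map_add₂ P.comp _ _ _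
  add_smul a b v := (congrArg (P.comp (pic v))
    (layer_add (unop a : P.Hom ε 1 1) (unop b : P.Hom ε 1 1))).trans (map_add _ _ _)
  zero_smul v := (congrArg (P.comp (pic v)) layer_zero).trans (map_zero _)

instance : IsScalarTower ℂ (P.Box ε 1) (P.Leg h) where
  smul_assoc c a v := LinearMap.map_smul₂ P.comp c (a : P.Hom ε 1 1) (pic v)

instance : IsScalarTower ℂ (P.Box ε 1)ᵐᵒᵖ (P.Leg h) where
  smul_assoc c a v := (congrArg (P.comp (pic v)) (layer_smul c (unop a : P.Hom ε 1 1))).trans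
    (map_smul (P.comp (pic v)) c _)

instance : SMulCommClass (P.Box ε 1) (P.Box ε 1)ᵐᵒᵖ (P.Leg h) where
  smul_comm a _ v := (P.comp_assoc (a : P.Hom ε 1 1) (pic v) _).symm

theorem isCorrespondence : FiniteCStar.IsCorrespondence (ip (P := P) (h := h)) where
  add_left v w u := LinearMap.map_add₂ P.comp (pic v) (pic w) _
  smul_left a v w := P.comp_assoc (a : P.Hom ε 1 1) (pic v) _
  star_ip v w := (P.dagger_comp _ _).trans
    (congrArg (fun l => P.comp l (P.dagger (pic v))) (P.dagger_dagger (pic w)))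
  op_smul_left a v w := by
    have e : ∀ b : P.Hom ε 1 1, P.dagger (P.comp (pic w) (layer ε η 0 2 3 3 (P.dagger b))) =
        P.comp (layer ε η 0 2 3 3 b) (P.dagger (pic w)) := by
      intro b
      rw [P.dagger_comp, dagger_layer, P.dagger_dagger]
    exact (P.comp_assoc (pic v) _ _).trans (congrArg (P.comp (pic v)) (e a)).symm
  nonneg v := isPos_comp_dagger h (pic v)
  definite v hv := eq_zero_of_comp_dagger h (v := pic v) hv

end Leg

/-- The transfer operator `a ↦ a ∗ k`. -/
def transfer (h : η = !ε) (k : P.Hom η 2 2) : P.Box ε 1 →ₗ[ℂ] P.Box ε 1 where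
  toFun a := convLeft (P := P) h a k
  map_add' a b := by
    refine (convLeft_eq h _ k).trans (Eq.trans ?_
      (congrArg₂ (fun v w : P.Hom ε 1 1 => v + w) (convLeft_eq h a k) (convLeft_eq h b k)).symm)
    refine (congrArg (fun l => P.comp _ (P.comp l _))
      (layer_add (a : P.Hom ε 1 1) (b : P.Hom ε 1 1))).trans ?_
    exact (congrArg (P.comp _) (LinearMap.map_add₂ P.comp _ _ _)).trans (map_add _ _ _)
  map_smul' c a := by
    refine (convLeft_eq h _ k).trans (Eq.trans ?_
      (congrArg (fun v : P.Hom ε 1 1 => c • v) (convLeft_eq h a k)).symm)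
    refine (congrArg (fun l => P.comp _ (P.comp l _))
      (layer_smul c (a : P.Hom ε 1 1))).trans ?_
    exact (congrArg (P.comp _) (LinearMap.map_smul₂ P.comp _ _ _)).trans (map_smul _ _ _)

theorem transfer_apply (h : η = !ε) (k : P.Hom η 2 2) (a : P.Box ε 1) :
    transfer h k a = convLeft (P := P) h a k := rfl

/-- The picture `k` with its lower left string bent up and continued to the lower edge. -/
def stem (h : η = !ε) (k : P.Hom η 2 2) : P.Leg h :=
  Leg.of h (P.comp (layer ε ε 0 1 1 3 (P.cup ε)) (layer ε η 1 0 3 3 k))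

/-- Cutting `z z†` between its two factors splits the picture of `a ∗ z z†`. This is the only place
where positivity of `x̂` enters the form of `S`. -/
theorem transfer_eq_ip (h : η = !ε) (z : P.Hom η 2 2) (a : P.Box ε 1) :
    transfer h (P.comp z (P.dagger z)) a = Leg.ip (op a • stem h z) (stem h z) := by
  have e1 : layer ε η 1 0 3 3 (P.comp z (P.dagger z)) =
      P.comp (layer ε η 1 0 3 3 z) (layer ε η 1 0 3 3 (P.dagger z)) :=
    layer_comp_eq (fun _ => rfl) fun _ _ => rfl
  have e2 : P.comp (layer ε η 1 0 3 3 z) (layer ε η 0 2 3 3 (a : P.Hom ε 1 1)) =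
      P.comp (layer ε η 0 2 3 3 (a : P.Hom ε 1 1)) (layer ε η 1 0 3 3 z) := (layer_comm 0).symm
  have e3 : P.dagger (P.comp (layer ε ε 0 1 1 3 (P.cup ε)) (layer ε η 1 0 3 3 z)) =
      P.comp (layer ε η 1 0 3 3 (P.dagger z)) (layer ε ε 0 1 3 1 (P.cap ε)) := by
    rw [P.dagger_comp, dagger_layer, dagger_layer, P.dagger_cup]
  have key : P.comp (P.comp (P.comp (layer ε ε 0 1 1 3 (P.cup ε)) (layer ε η 1 0 3 3 z))
      (layer ε η 0 2 3 3 (a : P.Hom ε 1 1)))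
      (P.dagger (P.comp (layer ε ε 0 1 1 3 (P.cup ε)) (layer ε η 1 0 3 3 z))) =
      P.comp (layer ε ε 0 1 1 3 (P.cup ε)) (P.comp (layer ε η 0 2 3 3 (a : P.Hom ε 1 1))
        (P.comp (layer ε η 1 0 3 3 (P.comp z (P.dagger z))) (layer ε ε 0 1 3 1 (P.cap ε)))) := by
    rw [e3, e1]
    simp only [P.comp_assoc]
    rw [comp_comp_congr e2]
  exact (convLeft_eq h a _).trans key.symm

section exchange

variable (h : η = !ε) {x : P.Hom ε 2 2} {z : P.Hom η 2 2}
  (hx : fourier (P := P) h x = P.comp z (P.dagger z)) {c : P.Hom ε 1 1}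
  (hc : P.comp c (P.comp (layer ε ε 0 1 1 3 (P.cup ε)) (layer ε η 1 0 3 3 z)) =
    P.comp (P.comp (layer ε ε 0 1 1 3 (P.cup ε)) (layer ε η 1 0 3 3 z)) (layer ε η 0 2 3 3 c))
include hx hc

/-- The factor `z†` does not touch the first upper string, so the relation for `z` extends to `z z†
= x̂`. -/
theorem onRight_comm : P.comp x (layer ε ε 1 0 2 2 (conj (P := P) h c)) =
    P.comp (layer ε ε 1 0 2 2 (conj (P := P) h c)) x := by
  have e1 : layer ε η 1 0 3 3 (P.comp z (P.dagger z)) =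
      P.comp (layer ε η 1 0 3 3 z) (layer ε η 1 0 3 3 (P.dagger z)) :=
    layer_comp_eq (fun _ => rfl) fun _ _ => rfl
  have e2 : P.comp (layer ε η 0 2 3 3 c) (layer ε η 1 0 3 3 (P.dagger z)) =
      P.comp (layer ε η 1 0 3 3 (P.dagger z)) (layer ε η 0 2 3 3 c) := layer_comm 0
  apply comm_conj_of_fourier h
  rw [hx, e1, ← P.comp_assoc _ _ (layer ε η 1 0 3 3 (P.dagger z)), ← P.comp_assoc, hc,
    P.comp_assoc, e2, ← P.comp_assoc _ _ (layer ε η 0 2 3 3 c)]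

/-- The adjoint of the relation lets `c` pass from the first lower string of the reflected stem to
its single upper string; capped, `x̂` is `x` with one string bent, so `c` passes along the left
string of `x`. -/
theorem onLeft_comm (hcs : P.dagger c = c) :
    P.comp x (layer ε η 0 1 2 2 c) = P.comp (layer ε η 0 1 2 2 c) x := by
  have e1 : layer ε η 1 0 3 3 (P.comp z (P.dagger z)) =
      P.comp (layer ε η 1 0 3 3 z) (layer ε η 1 0 3 3 (P.dagger z)) :=
    layer_comp_eq (fun _ => rfl) fun _ _ => rfl
  have e2 : P.comp (layer ε η 1 0 3 3 z) (layer ε η 0 2 3 3 c) =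
      P.comp (layer ε η 0 2 3 3 c) (layer ε η 1 0 3 3 z) := (layer_comm 0).symm
  have e3 := congrArg P.dagger hc
  rw [P.dagger_comp, P.dagger_comp, P.dagger_comp, P.dagger_comp, dagger_layer, dagger_layer,
    dagger_layer, hcs, P.dagger_cup] at e3
  apply comm_of_bend_comm h
  rw [← fourier_cap, hx, e1]
  simp only [P.comp_assoc] at e3 ⊢
  rw [← comp_comp_congr e2, ← e3]

end exchange

theorem mem_exchange_iff (h : η = !ε) (x : P.Hom ε 2 2) (c : P.Hom ε 1 1) :
    c ∈ exchange (P := P) h x ↔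
      P.comp x (layer ε ε 1 0 2 2 (conj (P := P) h c)) =
        P.comp (layer ε ε 1 0 2 2 (conj (P := P) h c)) x ∧
      P.comp x (layer ε η 0 1 2 2 c) = P.comp (layer ε η 0 1 2 2 c) x :=
  and_congr
    (congrArg (fun l : P.Hom ε 2 2 => P.comp x l = P.comp l x) (onRight_eq h _)).to_iff
    (congrArg (fun l : P.Hom ε 2 2 => P.comp x l = P.comp l x) (onLeft_eq h _)).to_iff

/-- A `1`-box that can be moved between the two sides of the stem of a square root of `x̂` belongs
to the exchange algebra. -/
theorem mem_exchange (h : η = !ε) {x : P.Box ε 2} {z : P.Hom η 2 2}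
    (hx : fourier h x = P.comp z (P.dagger z)) {c : P.Box ε 1} (hcs : star c = c)
    (hc : c • stem h z = op c • stem h z) : c ∈ exchange h x :=
  (mem_exchange_iff h x c).2 ⟨onRight_comm h hx hc, onLeft_comm h hx hc hcs⟩

end CStarPlanarAlgebra

/-! ### Range projections and faithfulness in the box spaces. -/

namespace CStarPlanarAlgebra
open PlanarStarAlgebra MulOpposite FiniteCStar

variable {P : CStarPlanarAlgebra.{u}} {ε η : Shading}

theorem isRangeProjection_rangeProj {n : ℕ} {y : P.Box ε n} (hy : IsSelfAdjoint y) :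
    IsRangeProjection (rangeProj y) y :=
  Classical.epsilon_spec (p := fun q => IsRangeProj q y) ⟨support y, isRangeProjection_support hy⟩

theorem rangeProj_eq_support {n : ℕ} {y : P.Box ε n} (hy : IsSelfAdjoint y) :
    rangeProj y = support y :=
  (isRangeProjection_rangeProj hy).unique (isRangeProjection_support hy)

theorem IsPos.isSelfAdjoint {n : ℕ} {y : P.Box ε n} (hy : IsPos y) : IsSelfAdjoint y := by
  obtain ⟨b, rfl⟩ := hy
  exact .mul_star_self b

theorem IsMaxProj.unique {h : η = !ε} {x : P.Box ε 2} {p q : P.Box ε 1} (hp : IsMaxProj h x p)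
    (hq : IsMaxProj h x q) : p = q := by
  obtain ⟨⟨y, hy, rfl⟩, hp⟩ := hp
  obtain ⟨⟨z, hz, rfl⟩, hq⟩ := hq
  have hy' := (isRangeProjection_rangeProj hy.2.isSelfAdjoint).1.isSelfAdjoint.star_eq
  have hz' := (isRangeProjection_rangeProj hz.2.isSelfAdjoint).1.isSelfAdjoint.star_eq
  have := congrArg star (hp z hz)
  rw [star_mul, hy', hz'] at this
  rw [← this, hq y hy]

theorem pairing_smul (h : η = !ε) (k : ℂ) (z : P.Hom η 1 1) (a : P.Box ε 1) :
    pairing h (k • z) a = k • pairing h z a := by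
  have e : ∀ a : P.Hom ε 1 1, pairing h (k • z) a = (k • pairing h z a : P.Hom ε 0 0) := by
    intro a
    rw [pairing_apply, pairing_apply, layer_smul, LinearMap.map_smul₂, map_smul, map_smul]
    rfl
  exact e a

/-- Faithfulness of the functional on `p`: the range projection of `t t*` is a left multiple of
`t*`, so its conjugate is covered by `mul_conj_eq_zero`. -/
theorem conj_rangeProj_mul_eq_zero (h : η = !ε) {t : P.Box η 1} {p : P.Box ε 1}
    (hp : p = conj (opp_symm h) (rangeProj (t * star t))) (hps : star p = p) {a : P.Box ε 1}
    (ha : pairing h (P.comp t (P.dagger t)) (a * star a) = 0) : p * a = 0 := by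
  have hs : IsSelfAdjoint (t * star t) := .mul_star_self t
  obtain ⟨g, hg⟩ := (isRangeProjection_rangeProj hs).exists_eq_mul' hs
  have hga : rangeProj (t * star t) = P.comp (g * t) (P.dagger t) := hg.trans (mul_assoc _ _ _).symm
  have h1 : star a * p = 0 := by
    rw [hp, hga]
    exact mul_conj_eq_zero h (t := t) (g := g * t) (a := a) ha
  have h2 := congrArg star h1
  rwa [star_mul, star_star, hps, star_zero] at h2

theorem transfer_nonneg (h : η = !ε) (z : P.Hom η 2 2) [PartialOrder (P.Box ε 1)]
    [StarOrderedRing (P.Box ε 1)] {a : P.Box ε 1} (ha : 0 ≤ a) :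
    0 ≤ transfer h (P.comp z (P.dagger z)) a := by
  obtain ⟨b, rfl⟩ := nonneg_iff_exists.1 ha
  rw [transfer_eq_ip, ← Leg.isCorrespondence.ip_op_op, nonneg_iff_exists]
  exact Leg.isCorrespondence.nonneg _

end CStarPlanarAlgebra

end

open CStarPlanarAlgebra FiniteCStar in
theorem proposition5p8 (P : CStarPlanarAlgebra.{u}) {ε η : Shading} (h : η = !ε) (x : P.Box ε 2)
    (hx : CStarPlanarAlgebra.IsFPos h x)
    (hright : ∃ y₁ : P.Box η 1, CStarPlanarAlgebra.IsRightPFEigenvector h x y₁ ∧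
      CStarPlanarAlgebra.pMax h x =
        CStarPlanarAlgebra.conj (opp_symm h) (CStarPlanarAlgebra.rangeProj y₁))
    (hcomm : ∀ y ∈ CStarPlanarAlgebra.eigenPos h x,
      CStarPlanarAlgebra.zeta h x * CStarPlanarAlgebra.rangeProj y =
        CStarPlanarAlgebra.rangeProj y * CStarPlanarAlgebra.zeta h x) :
    CStarPlanarAlgebra.eigenPos h x =
      (fun c => CStarPlanarAlgebra.zeta h x * c) '' CStarPlanarAlgebra.exchangePos h x := by
  let _ : PartialOrder (P.Box ε 1) := CStarAlgebra.spectralOrder _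
  have : StarOrderedRing (P.Box ε 1) := CStarAlgebra.spectralOrderedRing _
  obtain ⟨z, hz⟩ : ∃ z : P.Hom η 2 2, fourier h x = P.comp z (P.dagger z) := hx
  obtain ⟨S, hS⟩ : ∃ S, S = transfer h (P.comp z (P.dagger z)) := ⟨_, rfl⟩
  have hSa : ∀ a, S a = convLeft h a (fourier h x) := fun a => by
    rw [hS, transfer_apply, hz]
  have hSpos : ∀ a, 0 ≤ a → 0 ≤ S a := fun a ha => hS ▸ transfer_nonneg h z ha
  have hmem : ∀ y, y ∈ eigenPos h x ↔ y ∈ eigenCone S (specRad x) := fun y => by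
    rw [eigenCone, Set.mem_ofPred_eq, hSa, nonneg_iff_exists]
    rfl
  obtain ⟨y₀, hy₀, hmax⟩ := exists_mem_eigenCone_max S (specRad x)
  obtain ⟨ζ, hζ, hlim, hpζ⟩ := exists_tendsto_support (r := specRad x) hSpos ENNReal.toReal_nonneg hy₀ hmax
  -- The maximal projection and the range projections are chosen by `epsilon`; existence and
  -- uniqueness identify them with supports.
  have hp : pMax h x = support y₀ := by
    have hm : IsMaxProj h x (support y₀) := by
      refine ⟨⟨y₀, (hmem y₀).2 hy₀, (rangeProj_eq_support (.of_nonneg hy₀.2)).symm⟩,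
        fun y hy => ?_⟩
      exact (isRangeProjection_rangeProj hy.2.isSelfAdjoint).2.2 _ hpζ.1 (hmax y ((hmem y).1 hy))
    exact (Classical.epsilon_spec (p := fun p => IsMaxProj h x p) ⟨_, hm⟩ : IsMaxProj h x _).unique hm
  have hzeta : zeta h x = ζ := by
    rw [zeta, hp, ← hlim.limUnder_eq]
    congr 1
    ext w
    rw [neumann, show (⇑S) = fun y => convLeft h y (fourier h x) from funext hSa]
  rw [hzeta] at hcomm ⊢
  obtain ⟨y₁, ⟨-, ⟨t, rfl⟩, hy₁⟩, hpy⟩ := hright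
  rw [hp] at hpy
  ext y
  rw [hmem]
  constructor
  · intro hy
    -- The functional is the pairing with `y₁ = t t*`. Its invariance is the eigenvector equation of
    -- `y₁`, and its support property and faithfulness come from `p` being the conjugate of the
    -- range projection of `y₁`.
    have hfactor : ∃ c, 0 ≤ c ∧ ζ * c = y ∧ c • stem h z = MulOpposite.op c • stem h z := by
      refine exists_commuting_factor (S := S) Leg.isCorrespondence
        (fun a => by rw [hS, transfer_eq_ip]) (φ := pairing h (P.comp t (P.dagger t)))
        (fun a => ?_) (fun a => ?_) (fun a ha => ?_) hζ.2 hζ.1 hpζ (fun w hw hSw q hq => ?_)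
        hy.2 hy.1 (hmax y hy)
      · rw [hSa]
        refine (pairing_convLeft h _ _ _).trans ?_
        refine (congrArg (fun l => pairing h l a) hy₁).trans ?_
        exact pairing_smul h _ _ a
      · have hs : IsSelfAdjoint (t * star t) := .mul_star_self t
        rw [hpy]
        exact pairing_mul h ((isRangeProjection_rangeProj hs).mul_right hs) a
      · exact conj_rangeProj_mul_eq_zero h hpy hpζ.1.isSelfAdjoint.star_eq ha
      · have hw' : w ∈ eigenPos h x := (hmem w).2 ⟨hSw, hw⟩
        rw [hq.unique (isRangeProjection_rangeProj hw'.2.isSelfAdjoint)]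
        exact hcomm w hw'
    obtain ⟨c, hc, hζc, hcV⟩ := hfactor
    exact ⟨c, ⟨mem_exchange h hz (IsSelfAdjoint.of_nonneg hc).star_eq hcV,
      nonneg_iff_exists.1 hc⟩, hζc⟩
  · rintro ⟨c, ⟨hcx, hc⟩, rfl⟩
    have hcx := (mem_exchange_iff h x c).1 hcx
    refine mul_mem_eigenCone hy₀ hmax hζ hlim (nonneg_iff_exists.2 hc) (fun a => ?_) fun a => ?_
    · rw [hSa, hSa]
      exact mul_convLeft h hcx.1 a
    · rw [hSa, hSa]
      exact convLeft_mul h hcx.2 a
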